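/- **The theories.** The terms and formulas of $EA_0$ are defined simultaneously. Terms are built from free variables and $\varnothing$ by pair set $\{s,t\}$, power set $\mathrm P(s)$, union $\bigcup s$, epsilon fan $\epsilon(s)$, comprehension $\{x\in s:A\}$ ($A$ an $EA_0$-formula) and replacement $\{t:x\in s\}$. Formulas are built from $s\in t$, $s=t$, $s\subseteq t$ by the propositional connectives. Bounded quantifiers are abbreviations: $(\forall x\in s)A$ is $s\subseteq\{x\in s:A\}$, and $(\exists x\in s)A$ is $\neg(\forall x\in s)\neg A$. Kuratowski pairs, local functions and the relations $\simeq_c$ (a bijection exists), $\le_c$ (an injection exists) and $<_c$ are defined by $EA_0$-formulas in the usual way. A linear ordering $[a_1,\dots,a_n]$ is coded as the set $L=\{\{a_1\},\{a_1,a_2\},\dots,\{a_1,\dots,a_n\}\}$, that is: $\varnothing\notin L$; if $L\ne\varnothing$ then $L$ contains a singleton; each $x\in L$ is $\bigcup L$ or has some $y\in\bigcup L$, $y\notin x$, with $x\cup\{y\}\in L$; and $L$ is totally ordered by $\subseteq$. Its field is $\bigcup L$, and $[\,]=\varnothing$. The theory $EA_1$ is classical first-order logic with identity over this language with unbounded quantifiers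 added to formulas (but not allowed inside terms), together with: the defining axioms of $\varnothing$, pair set, power set, union, comprehension and replacement; the axiom $\subseteq$-elimination and the rule $\subseteq$-introduction; extensionality; Dedekind finiteness $a\subsetneq b\supset a<_c b$; the axiom that $a\in\epsilon(b)$ iff $a$ is a non-empty linear ordering whose first term lies in $b$ and each of whose later terms is a member of its immediate predecessor; and foundation $a\in \mathrm{TC}(b)\supset b\notin \mathrm{TC}(a)$, where $\mathrm{TC}(s)=\bigcup\{\mathrm{Field}(x):x\in\epsilon(s)\}$. **Global functions.** An $n$-ary global function is given by an $EA_0$-term with no free variables other than its $n$ arguments. A unary global function $\varphi$ is arithmetical if $EA_1\vdash\forall x\forall y[x\simeq_c y\supset\varphi(x)\simeq_c\varphi(y)]$, and increasing if $EA_1\vdash\forall x\forall y[x\le_c y\supset\varphi(x)\le_c\varphi(y)]$. For a natural number $n$ of the metatheory, $\varphi^n$ is the $n$-fold iterate. Numerals are $\mathbf 0=\varnothing$, $\mathbf{n+1}=\mathbf n\cup\{\mathbf n\}$, and $a+_cb=(a\times\{\mathbf 0\})\cup(b\times\{\mathbf 1\})$. **Systems.** For a closed term $a$ and a unary global function $\sigma$,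 "$L$ in $\mathcal N_{\sigma,a}$" says that $L$ is a linear ordering which is $[\,]$, or is non-empty with $\mathrm{First}(L)=a$ and $\mathrm{Next}_L(x)=\sigma(x)$ for each $x\in\mathrm{Field}(L)$ other than $\mathrm{Last}(L)$. $\mathcal N_{\sigma,a}$ is a natural number system if $EA_1$ proves that $L$ in $\mathcal N_{\sigma,a}$ implies $\sigma(\mathrm{Last}(L))\notin\mathrm{Field}(L)$. $\mathcal{CH}$, $\mathcal{VN}$, $\mathcal Z$ are the systems with $a=\varnothing$ and $\sigma(x)=\mathrm P(x)$, $x\cup\{x\}$, $\{x\}$ respectively. $\mathcal N$ is closed under a unary arithmetical $\varphi$ if there is a unary global function $\eta$ with $EA_1\vdash\forall x[x\text{ in }\mathcal N\supset(\eta(x)\text{ in }\mathcal N\ \&\ \varphi(x)\simeq_c\eta(x))]$; similarly for binary functions. $\varphi$ eventually dominates $\psi$ on $\mathcal N$ if for some natural number $M$ of the metatheory, $EA_1\vdash\forall x[(x\text{ in }\mathcal N\ \&\ \mathbf M\le_c x)\supset\psi(x)<_c\varphi(x)]$. An increasing unary arithmetical $\varphi$ is maximally powerful in a natural number system $\mathcal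 N$ if $\mathcal N$ is closed under $\varphi$ and, for every unary arithmetical global function $\psi$ under which $\mathcal N$ is closed, there is a natural number $n$ of the metatheory such that $\varphi^n$ eventually dominates $\psi$ on $\mathcal N$. **Theorem.** Let $\mathcal N$ be any one of $\mathcal{CH}$, $\mathcal{VN}$, $\mathcal Z$. Then $\mathcal N$ is a natural number system, $\lambda x\,(x+_c\mathbf 1)$ is an increasing unary arithmetical global function, and it is maximally powerful in $\mathcal N$. Moreover, $\mathcal N$ is closed under every finite iterate $(\lambda x\,(x+_c\mathbf 1))^n$, and $\mathcal N$ is not closed under the binary function $\lambda xy\,(x+_cy)$. -/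

import Mathlib

namespace EA

/-! ## Syntax

Variables are de Bruijn indices. Terms and formulas are defined simultaneously, as one inductive
family indexed by the kind of the expression. -/

/-- The kinds of expressions: terms (the same for both theories), the formulas of `EA₀`
(`formula false`, no unbounded quantifiers), and the formulas of `EA₁` (`formula true`). -/
inductive Kind : Type
  | term : Kind
  | formula (quantified : Bool) : Kind

/-- The terms and formulas of `EA₀` and `EA₁`. In `sep s A`, which is `{x ∈ s : A}`, the variable
`0` is bound in `A`; in `repl t s`, which is `{t : x ∈ s}`, it is bound in `t`; in `all A` and
`ex A` it is bound in `A`. The formula in a comprehension term is always a formula of `EA₀`. -/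
inductive Expr : Kind → Type
  | var (i : ℕ) : Expr Kind.term
  | empty : Expr Kind.term
  | pair (s t : Expr Kind.term) : Expr Kind.term
  | pow (s : Expr Kind.term) : Expr Kind.term
  | union (s : Expr Kind.term) : Expr Kind.term
  | fan (s : Expr Kind.term) : Expr Kind.term
  | sep (s : Expr Kind.term) (A : Expr (Kind.formula false)) : Expr Kind.term
  | repl (t s : Expr Kind.term) : Expr Kind.term
  | mem {b : Bool} (s t : Expr Kind.term) : Expr (Kind.formula b)
  | eq {b : Bool} (s t : Expr Kind.term) : Expr (Kind.formula b)
  | sub {b : Bool} (s t : Expr Kind.term) : Expr (Kind.formula b)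
  | neg {b : Bool} (A : Expr (Kind.formula b)) : Expr (Kind.formula b)
  | and {b : Bool} (A B : Expr (Kind.formula b)) : Expr (Kind.formula b)
  | or {b : Bool} (A B : Expr (Kind.formula b)) : Expr (Kind.formula b)
  | imp {b : Bool} (A B : Expr (Kind.formula b)) : Expr (Kind.formula b)
  | all (A : Expr (Kind.formula true)) : Expr (Kind.formula true)
  | ex (A : Expr (Kind.formula true)) : Expr (Kind.formula true)

/-- Terms. -/
abbrev Tm : Type := Expr Kind.term

/-- Formulas: of `EA₀` for `b = false`, of `EA₁` for `b = true`. -/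
abbrev Fm (b : Bool) : Type := Expr (Kind.formula b)

namespace Expr

/-- Extension of a renaming under a binder. -/
def liftRen (r : ℕ → ℕ) : ℕ → ℕ
  | 0 => 0
  | i + 1 => r i + 1

/-- Renaming of free variables. -/
def rename : {k : Kind} → (ℕ → ℕ) → Expr k → Expr k
  | _, r, var i => var (r i)
  | _, _, empty => empty
  | _, r, pair s t => pair (rename r s) (rename r t)
  | _, r, pow s => pow (rename r s)
  | _, r, union s => union (rename r s)
  | _, r, fan s => fan (rename r s)
  | _, r, sep s A => sep (rename r s) (rename (liftRen r) A)
  | _, r, repl t s => repl (rename (liftRen r) t) (rename r s)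
  | _, r, mem s t => mem (rename r s) (rename r t)
  | _, r, eq s t => eq (rename r s) (rename r t)
  | _, r, sub s t => sub (rename r s) (rename r t)
  | _, r, neg A => neg (rename r A)
  | _, r, and A B => and (rename r A) (rename r B)
  | _, r, or A B => or (rename r A) (rename r B)
  | _, r, imp A B => imp (rename r A) (rename r B)
  | _, r, all A => all (rename (liftRen r) A)
  | _, r, ex A => ex (rename (liftRen r) A)

/-- Weakening by one fresh variable: the expression read under one more binder. -/
def up {k : Kind} (e : Expr k) : Expr k := rename Nat.succ e

/-- The substitution that maps `0` to `t` and `i + 1` to `f i`. -/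
def scons (t : Tm) (f : ℕ → Tm) : ℕ → Tm
  | 0 => t
  | i + 1 => f i

/-- Extension of a substitution under a binder. -/
def liftSub (f : ℕ → Tm) : ℕ → Tm := scons (var 0) (fun i => up (f i))

/-- Simultaneous capture-avoiding substitution for the free variables. -/
def subst : {k : Kind} → (ℕ → Tm) → Expr k → Expr k
  | _, f, var i => f i
  | _, _, empty => empty
  | _, f, pair s t => pair (subst f s) (subst f t)
  | _, f, pow s => pow (subst f s)
  | _, f, union s => union (subst f s)
  | _, f, fan s => fan (subst f s)
  | _, f, sep s A => sep (subst f s) (subst (liftSub f) A)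
  | _, f, repl t s => repl (subst (liftSub f) t) (subst f s)
  | _, f, mem s t => mem (subst f s) (subst f t)
  | _, f, eq s t => eq (subst f s) (subst f t)
  | _, f, sub s t => sub (subst f s) (subst f t)
  | _, f, neg A => neg (subst f A)
  | _, f, and A B => and (subst f A) (subst f B)
  | _, f, or A B => or (subst f A) (subst f B)
  | _, f, imp A B => imp (subst f A) (subst f B)
  | _, f, all A => all (subst (liftSub f) A)
  | _, f, ex A => ex (subst (liftSub f) A)

/-- `e[t/x₀]`: the variable `0` is replaced by `t` and removed from the context. -/
def inst {k : Kind} (e : Expr k) (t : Tm) : Expr k := subst (scons t var) e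

/-- `e[s/x₀, t/x₁]`. -/
def inst₂ {k : Kind} (e : Expr k) (s t : Tm) : Expr k := subst (scons s (scons t var)) e

/-- All free variables of the expression are among the variables `0, …, n - 1`. -/
def FreeBelow : {k : Kind} → ℕ → Expr k → Prop
  | _, n, var i => i < n
  | _, _, empty => True
  | _, n, pair s t => FreeBelow n s ∧ FreeBelow n t
  | _, n, pow s => FreeBelow n s
  | _, n, union s => FreeBelow n s
  | _, n, fan s => FreeBelow n s
  | _, n, sep s A => FreeBelow n s ∧ FreeBelow (n + 1) A
  | _, n, repl t s => FreeBelow (n + 1) t ∧ FreeBelow n s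
  | _, n, mem s t => FreeBelow n s ∧ FreeBelow n t
  | _, n, eq s t => FreeBelow n s ∧ FreeBelow n t
  | _, n, sub s t => FreeBelow n s ∧ FreeBelow n t
  | _, n, neg A => FreeBelow n A
  | _, n, and A B => FreeBelow n A ∧ FreeBelow n B
  | _, n, or A B => FreeBelow n A ∧ FreeBelow n B
  | _, n, imp A B => FreeBelow n A ∧ FreeBelow n B
  | _, n, all A => FreeBelow (n + 1) A
  | _, n, ex A => FreeBelow (n + 1) A

/-- Every formula of `EA₀` is a formula of `EA₁`. -/
def toEA1 : Fm false → Fm true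
  | mem s t => mem s t
  | eq s t => eq s t
  | sub s t => sub s t
  | neg A => neg (toEA1 A)
  | and A B => and (toEA1 A) (toEA1 B)
  | or A B => or (toEA1 A) (toEA1 B)
  | imp A B => imp (toEA1 A) (toEA1 B)

end Expr

open _root_.EA.Expr

/-! ## Defined notions of `EA₀` -/

section Defined

variable {b : Bool}

/-- Equivalence `A ≡ B`. -/
def iff (A B : Fm b) : Fm b := and (imp A B) (imp B A)

/-- The local quantifier `(∀ x ∈ s) A`, which is `s ⊆ {x ∈ s : A}`. -/
def ball (s : Tm) (A : Fm false) : Fm b := sub s (sep s A)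

/-- The local quantifier `(∃ x ∈ s) A`, which is `¬ (∀ x ∈ s) ¬ A`. -/
def bex (s : Tm) (A : Fm false) : Fm b := neg (ball s (neg A))

/-- `{s}`. -/
def single (s : Tm) : Tm := pair s s

/-- `s ∪ t`. -/
def cup (s t : Tm) : Tm := union (pair s t)

/-- The Kuratowski ordered pair `(s, t)`. -/
def opair (s t : Tm) : Tm := pair (single s) (pair s t)

/-- The Cartesian product `s × t`. -/
def prod (s t : Tm) : Tm := union (repl (repl (opair (var 1) (var 0)) t.up) s)

/-- `f` is a local function from `s` to `t`. -/
def isFun (f s t : Tm) : Fm b :=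
  and (sub f (prod s t))
    (ball s (bex t.up
      (and (mem (opair (var 1) (var 0)) f.up.up)
        (ball t.up.up
          (imp (mem (opair (var 2) (var 0)) f.up.up.up) (eq (var 0) (var 1)))))))

/-- The local function `f` from `s` to `t` is injective. -/
def isInj (f s t : Tm) : Fm b :=
  ball s (ball s.up (ball t.up.up
    (imp (and (mem (opair (var 2) (var 0)) f.up.up.up) (mem (opair (var 1) (var 0)) f.up.up.up))
      (eq (var 2) (var 1)))))

/-- The local function `f` from `s` to `t` is surjective. -/
def isSurj (f s t : Tm) : Fm b :=
  ball t (bex s.up (mem (opair (var 0) (var 1)) f.up.up))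

/-- Cardinal equivalence `s ≃_c t`. -/
def ceq (s t : Tm) : Fm b :=
  bex (pow (prod s t))
    (and (isFun (var 0) s.up t.up) (and (isInj (var 0) s.up t.up) (isSurj (var 0) s.up t.up)))

/-- Cardinal inequality `s ≤_c t`. -/
def cle (s t : Tm) : Fm b :=
  bex (pow (prod s t)) (and (isFun (var 0) s.up t.up) (isInj (var 0) s.up t.up))

/-- Strict cardinal inequality `s <_c t`. -/
def clt (s t : Tm) : Fm b := and (cle s t) (neg (ceq s t))

/-- Proper inclusion `s ⊊ t`. -/
def ssub (s t : Tm) : Fm b := and (sub s t) (neg (eq s t))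

/-! ### Linear orderings, as sets of the fields of their non-empty initial segments -/

/-- `Field(L)`. -/
def field (L : Tm) : Tm := union L

/-- `L` is a linear ordering (Kuratowski). -/
def isLinOrd (L : Tm) : Fm b :=
  and (neg (mem empty L))
  (and (imp (neg (eq L empty)) (bex L (bex (var 0) (eq (var 1) (single (var 0))))))
  (and (ball L (or (eq (var 0) (union L.up))
      (bex (union L.up)
        (and (neg (mem (var 0) (var 1))) (mem (cup (var 1) (single (var 0))) L.up.up)))))
    (ball L (ball L.up (or (sub (var 1) (var 0)) (sub (var 0) (var 1)))))))

/-- `s <_L t`. -/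
def ltOrd (L s t : Tm) : Fm b := bex L (and (mem s.up (var 0)) (neg (mem t.up (var 0))))

/-- `First(L)`: the union of the singleton of the element of the field that lies in every
non-empty initial segment. -/
def first (L : Tm) : Tm := union (sep (field L) (ball L.up (mem (var 1) (var 0))))

/-- `Last(L)`: the union of the singleton of the element of the field that lies in no proper
initial segment. -/
def last (L : Tm) : Tm :=
  union (sep (field L) (ball L.up (imp (mem (var 1) (var 0)) (eq (var 0) (field L.up.up)))))

/-- `Next_L(s)`: the immediate successor of `s` in `L`, and `Last(L)` if `s` is `Last(L)`. -/
def next (L s : Tm) : Tm :=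
  union (sep (field L)
    (or (and (eq s.up (last L.up)) (eq (var 0) s.up))
      (and (ltOrd L.up s.up (var 0))
        (ball (field L.up)
          (imp (ltOrd L.up.up s.up.up (var 0)) (neg (ltOrd L.up.up (var 0) (var 1))))))))

/-- `L` is an `∈`-chain for `s`. -/
def isChain (L s : Tm) : Fm b :=
  and (isLinOrd L)
  (and (neg (eq L empty))
  (and (mem (first L) s)
    (ball (field L)
      (imp (neg (eq (var 0) (last L.up))) (mem (next L.up (var 0)) (var 0))))))

/-- The transitive closure `TC(s)`. -/
def tc (s : Tm) : Tm := union (repl (field (var 0)) (fan s))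

end Defined

/-! ## The theory -/

/-- The axioms of `EA₀` (all instances by terms and formulas of `EA₀`). -/
inductive EA0Axiom : Fm false → Prop
  | emptySet (a : Tm) : EA0Axiom (neg (mem a empty))
  | pairSet (a s t : Tm) : EA0Axiom (iff (mem a (pair s t)) (or (eq a s) (eq a t)))
  | powerSet (a s : Tm) : EA0Axiom (iff (mem a (pow s)) (sub a s))
  | unionSet (a s : Tm) : EA0Axiom (iff (mem a (union s)) (bex s (mem a.up (var 0))))
  | subsetSelection (a s : Tm) (A : Fm false) :
      EA0Axiom (iff (mem a (sep s A)) (and (mem a s) (A.inst a)))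
  | replacement (a s t : Tm) :
      EA0Axiom (iff (mem a (repl t s)) (bex s (eq a.up t)))
  | subsetElim (a s t : Tm) : EA0Axiom (imp (and (sub s t) (mem a s)) (mem a t))
  | extensionality (s t : Tm) : EA0Axiom (imp (and (sub s t) (sub t s)) (eq s t))
  | dedekindFiniteness (s t : Tm) : EA0Axiom (imp (ssub s t) (clt s t))
  | epsilonFan (a s : Tm) : EA0Axiom (iff (mem a (fan s)) (isChain a s))
  | foundation (s t : Tm) : EA0Axiom (imp (mem s (tc t)) (neg (mem t (tc s))))

/-- Derivability in `EA₁` from a list of hypotheses: classical first-order natural deduction with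
identity, the axioms of `EA₀`, and the rule of inclusion introduction. -/
inductive Derives : List (Fm true) → Fm true → Prop
  | hyp {H : List (Fm true)} {A : Fm true} : A ∈ H → Derives H A
  | ax {H : List (Fm true)} {A : Fm false} : EA0Axiom A → Derives H A.toEA1
  | subIntro {H : List (Fm true)} {s t : Tm} :
      Derives (H.map up) (imp (mem (var 0) s.up) (mem (var 0) t.up)) → Derives H (sub s t)
  | andIntro {H : List (Fm true)} {A B : Fm true} :
      Derives H A → Derives H B → Derives H (and A B)
  | andLeft {H : List (Fm true)} {A B : Fm true} : Derives H (and A B) → Derives H A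
  | andRight {H : List (Fm true)} {A B : Fm true} : Derives H (and A B) → Derives H B
  | orLeft {H : List (Fm true)} {A B : Fm true} : Derives H A → Derives H (or A B)
  | orRight {H : List (Fm true)} {A B : Fm true} : Derives H B → Derives H (or A B)
  | orElim {H : List (Fm true)} {A B C : Fm true} :
      Derives H (or A B) → Derives (A :: H) C → Derives (B :: H) C → Derives H C
  | impIntro {H : List (Fm true)} {A B : Fm true} : Derives (A :: H) B → Derives H (imp A B)
  | impElim {H : List (Fm true)} {A B : Fm true} :
      Derives H (imp A B) → Derives H A → Derives H B
  | negIntro {H : List (Fm true)} {A B : Fm true} :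
      Derives (A :: H) B → Derives (A :: H) (neg B) → Derives H (neg A)
  | negNeg {H : List (Fm true)} {A : Fm true} : Derives H (neg (neg A)) → Derives H A
  | allIntro {H : List (Fm true)} {A : Fm true} : Derives (H.map up) A → Derives H (all A)
  | allElim {H : List (Fm true)} {A : Fm true} (t : Tm) :
      Derives H (all A) → Derives H (A.inst t)
  | exIntro {H : List (Fm true)} {A : Fm true} (t : Tm) :
      Derives H (A.inst t) → Derives H (ex A)
  | exElim {H : List (Fm true)} {A B : Fm true} :
      Derives H (ex A) → Derives (A :: H.map up) B.up → Derives H B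
  | eqRefl {H : List (Fm true)} (t : Tm) : Derives H (eq t t)
  | eqSubst {H : List (Fm true)} {s t : Tm} (A : Fm true) :
      Derives H (eq s t) → Derives H (A.inst s) → Derives H (A.inst t)

/-- `EA₁ ⊢ A`. -/
def Provable (A : Fm true) : Prop := Derives [] A

/-! ## Arithmetical global functions

A global function of `n` arguments is given by a term with all its free variables among
`0, …, n - 1`; the value at `s` is `φ.inst s`, and at `s, t` it is `φ.inst₂ s t`. -/

/-- The term defines a global function of `n` arguments (without parameters). -/
def IsGlobalFun (n : ℕ) (φ : Tm) : Prop := φ.FreeBelow n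

/-- `φ` is a unary arithmetical global function. -/
def IsArithmetical (φ : Tm) : Prop :=
  IsGlobalFun 1 φ ∧
    Provable (all (all (imp (ceq (var 1) (var 0)) (ceq (φ.inst (var 1)) (φ.inst (var 0))))))

/-- `φ` is increasing in its argument. -/
def IsIncreasing (φ : Tm) : Prop :=
  Provable (all (all (imp (cle (var 1) (var 0)) (cle (φ.inst (var 1)) (φ.inst (var 0))))))

/-- Cardinal successor `a ∪ {a}`, used for the numerals. -/
def csucc (s : Tm) : Tm := cup s (single s)

/-- The numeral of the metatheoretical natural number `n`. -/
def numeral : ℕ → Tm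
  | 0 => empty
  | n + 1 => csucc (numeral n)

/-- Cardinal addition `s +_c t`, which is `(s × {0}) ∪ (t × {1})`. -/
def cadd (s t : Tm) : Tm := cup (prod s (single (numeral 0))) (prod t (single (numeral 1)))

/-- The unary global function `λ x (x +_c 1)`. -/
def addOne : Tm := cadd (var 0) (numeral 1)

/-- The binary global function `λ x y (x +_c y)`. -/
def addition : Tm := cadd (var 0) (var 1)

/-- The iterate `φⁿ` of a unary global function. -/
def iter (φ : Tm) : ℕ → Tm
  | 0 => var 0
  | n + 1 => φ.inst (iter φ n)

/-! ## Natural number systems -/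

/-- An iteration system, given by its initial term and its successor function. -/
structure IterationSystem where
  zero : Tm
  succ : Tm
  zero_closed : zero.FreeBelow 0
  succ_unary : IsGlobalFun 1 succ

/-- `L in N`: the set `L` is a linear ordering generated from the initial term by the successor
function. -/
def IterationSystem.has {b : Bool} (N : IterationSystem) (L : Tm) : Fm b :=
  and (isLinOrd L)
    (or (eq L empty)
      (and (neg (eq L empty))
        (and (eq (first L) N.zero)
          (ball (field L)
            (imp (neg (eq (var 0) (last L.up))) (eq (next L.up (var 0)) (N.succ.inst (var 0))))))))

/-- `N` is a natural number system (provably in `EA₁`). -/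
def IterationSystem.IsNatSystem (N : IterationSystem) : Prop :=
  Provable (all (imp (isLinOrd (var 0))
    (imp (N.has (var 0)) (neg (mem (N.succ.inst (last (var 0))) (field (var 0)))))))

/-- `N` is closed under the unary arithmetical global function `φ`: some global function `η`
represents `φ` as a map from `N` to `N`, provably in `EA₁`. -/
def ClosedUnder (N : IterationSystem) (φ : Tm) : Prop :=
  ∃ η : Tm, IsGlobalFun 1 η ∧
    Provable (all (imp (N.has (var 0))
      (and (N.has (η.inst (var 0))) (ceq (φ.inst (var 0)) (η.inst (var 0))))))

/-- `N` is closed under the binary arithmetical global function `φ`. -/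
def ClosedUnder₂ (N : IterationSystem) (φ : Tm) : Prop :=
  ∃ η : Tm, IsGlobalFun 2 η ∧
    Provable (all (all (imp (and (N.has (var 1)) (N.has (var 0)))
      (and (N.has (η.inst₂ (var 1) (var 0)))
        (ceq (φ.inst₂ (var 1) (var 0)) (η.inst₂ (var 1) (var 0)))))))

/-- `φ` eventually dominates `ψ` on `N`. -/
def EventuallyDominatesOn (N : IterationSystem) (ψ φ : Tm) : Prop :=
  ∃ M : ℕ, Provable (all (imp (and (N.has (var 0)) (cle (numeral M) (var 0)))
    (clt (ψ.inst (var 0)) (φ.inst (var 0)))))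

/-- `φ` is an increasing unary arithmetical global function which is maximally powerful in the
natural number system `N`. -/
structure MaximallyPowerful (N : IterationSystem) (φ : Tm) : Prop where
  natSystem : N.IsNatSystem
  arithmetical : IsArithmetical φ
  increasing : IsIncreasing φ
  closedUnder : ClosedUnder N φ
  maximal : ∀ ψ : Tm, IsArithmetical ψ → ClosedUnder N ψ →
    ∃ n : ℕ, EventuallyDominatesOn N ψ (iter φ n)

/-- The von Neumann system: `0 = ∅`, `σ(x) = x ∪ {x}`. -/
def VN : IterationSystem where
  zero := empty
  succ := cup (var 0) (single (var 0))
  zero_closed := trivial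
  succ_unary := by simp [IsGlobalFun, cup, single, FreeBelow]

/-- The Zermelo system: `0 = ∅`, `σ(x) = {x}`. -/
def Zermelo : IterationSystem where
  zero := empty
  succ := single (var 0)
  zero_closed := trivial
  succ_unary := by simp [IsGlobalFun, single, FreeBelow]

/-- The cumulative hierarchy system: `0 = ∅`, `σ(x) = P(x)`. -/
def CH : IterationSystem where
  zero := empty
  succ := pow (var 0)
  zero_closed := trivial
  succ_unary := by simp [IsGlobalFun, FreeBelow]

end EA

/-!
The proof is semantic. By completeness (`provable_of_forall_model`) a formula is provable in `EA₁`
if it is true in all models, so the provability claims are shown by set theory inside an arbitrary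
model, where comprehension is available for properties definable by formulas of `EA₀`.

Dedekind finiteness yields induction along linear orderings (`LinOrd.induction`): a set of initial
segments closed under immediate successors would be mapped injectively into itself without its
first member. Since `x ∈ σ(x)` for each of the three successor functions, an element of a member
`L` of the system lies in the transitive closure of every later one, and foundation shows that
`σ(Last(L))` is new (`Has.not_mem_field`). Appending it to `L` is an `EA₀`-term, which represents
`x ↦ x +_c 1`; iterating it represents `x ↦ x +_c n`.

Maximality rests on a bound for the growth of ranks: over a transitive set `T`, each term takes
values included in the `k`-fold power set of `T`, for a number `k` that depends only on the term
(`exists_rankBound`). The field of a member `L` of the system is included in a transitive set `T`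
that does not contain the next element `s` (`RankedSystem`), and then `σᵏ(s)` is not in the
`k`-fold power set of `T`. So if `η(L)` is in the system, comparison along the ordering makes it a
proper subset of the `k`-th successor of `L`, with a suitable `k` depending only on `η`
(`exists_bound`); by Dedekind finiteness, `η(L) <_c L +_c k`.

The same bound refutes closure under addition: in the model of hereditarily finite sets `HF`, it
would give `L +_c L ≤_c L +_c k` for a fixed `k` and all `L` in the system.
-/

set_option linter.unusedSectionVars false

namespace EA

open _root_.EA.Expr

/-! ### Renaming and substitution -/

namespace Expr

theorem liftRen_liftRen (r r' : ℕ → ℕ) (i : ℕ) :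
    liftRen r (liftRen r' i) = liftRen (fun i => r (r' i)) i := by
  cases i <;> rfl

theorem rename_rename {k : Kind} (e : Expr k) (r r' : ℕ → ℕ) :
    rename r (rename r' e) = rename (fun i => r (r' i)) e := by
  induction e generalizing r r' <;> simp [rename, *, liftRen_liftRen]

theorem rename_up {k : Kind} (e : Expr k) (r : ℕ → ℕ) :
    rename (liftRen r) (up e) = up (rename r e) := by
  simp [up, rename_rename, liftRen]

theorem liftSub_liftRen (f : ℕ → Tm) (r : ℕ → ℕ) :
    (fun i => liftSub f (liftRen r i)) = liftSub (fun i => f (r i)) := by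
  funext i; cases i <;> rfl

theorem subst_rename {k : Kind} (e : Expr k) (f : ℕ → Tm) (r : ℕ → ℕ) :
    subst f (rename r e) = subst (fun i => f (r i)) e := by
  induction e generalizing f r <;> simp [rename, subst, *, liftSub_liftRen]

theorem rename_liftSub (f : ℕ → Tm) (r : ℕ → ℕ) :
    (fun i => rename (liftRen r) (liftSub f i)) = liftSub (fun i => rename r (f i)) := by
  funext i
  cases i with
  | zero => rfl
  | succ i => exact rename_up (f i) r

theorem rename_subst {k : Kind} (e : Expr k) (f : ℕ → Tm) (r : ℕ → ℕ) :
    rename r (subst f e) = subst (fun i => rename r (f i)) e := by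
  induction e generalizing f r <;> simp [rename, subst, *, rename_liftSub]

theorem subst_up {k : Kind} (e : Expr k) (f : ℕ → Tm) :
    subst (liftSub f) (up e) = up (subst f e) := by
  simp only [up, subst_rename, rename_subst]; rfl

theorem subst_liftSub (f g : ℕ → Tm) :
    (fun i => subst (liftSub f) (liftSub g i)) = liftSub (fun i => subst f (g i)) := by
  funext i
  cases i with
  | zero => rfl
  | succ i => exact subst_up (g i) f

theorem subst_subst {k : Kind} (e : Expr k) (f g : ℕ → Tm) :
    subst f (subst g e) = subst (fun i => subst f (g i)) e := by
  induction e generalizing f g <;> simp [subst, *, subst_liftSub]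

theorem liftSub_var : liftSub var = var := by
  funext i; cases i <;> rfl

theorem subst_var {k : Kind} (e : Expr k) : subst var e = e := by
  induction e <;> simp [subst, *, liftSub_var]

theorem inst_up {k : Kind} (e : Expr k) (t : Tm) : (up e).inst t = e := by
  simp only [inst, up, subst_rename, scons]; exact subst_var e

theorem rename_inst {k : Kind} (e : Expr k) (t : Tm) (r : ℕ → ℕ) :
    rename r (e.inst t) = (rename (liftRen r) e).inst (rename r t) := by
  simp only [inst, rename_subst, subst_rename]
  congr 1; funext i; cases i <;> rfl

theorem inst_subst_liftSub {k : Kind} (e : Expr k) (f : ℕ → Tm) (t : Tm) :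
    (subst (liftSub f) e).inst t = subst (scons t f) e := by
  simp only [inst, subst_subst]
  congr 1; funext i
  cases i with
  | zero => rfl
  | succ i => exact inst_up (f i) t

/-- Weakening below the bound variable, followed by the instantiation with that variable,
changes nothing. -/
theorem inst_var_zero {k : Kind} (e : Expr k) : (rename (liftRen Nat.succ) e).inst (var 0) = e := by
  simp only [inst, subst_rename]
  conv_rhs => rw [← subst_var e]
  congr 1; funext i; cases i <;> rfl

theorem FreeBelow.mono {k : Kind} {e : Expr k} {m n : ℕ} (h : e.FreeBelow m) (hmn : m ≤ n) :
    e.FreeBelow n := by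
  induction e generalizing m n <;> simp only [FreeBelow] at h ⊢
  case var => omega
  all_goals
    first
    | exact ⟨by apply_assumption; exact h.1; omega, by apply_assumption; exact h.2; omega⟩
    | (apply_assumption; exact h; omega)

theorem exists_freeBelow {k : Kind} (e : Expr k) : ∃ n, e.FreeBelow n := by
  have key : ∀ {k k' : Kind} {e : Expr k} {e' : Expr k'}, (∃ n, e.FreeBelow n) →
      (∃ n, e'.FreeBelow n) → ∃ n, e.FreeBelow n ∧ e'.FreeBelow n ∧ e.FreeBelow (n + 1) ∧
        e'.FreeBelow (n + 1) := by
    rintro k k' e e' ⟨m, hm⟩ ⟨n, hn⟩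
    exact ⟨max m n, hm.mono (by omega), hn.mono (by omega), hm.mono (by omega), hn.mono (by omega)⟩
  induction e with
  | var i => exact ⟨i + 1, Nat.lt_succ_self i⟩
  | empty => exact ⟨0, trivial⟩
  | pow s ih | union s ih | fan s ih | neg s ih => exact ih
  | pair s t ihs iht | mem s t ihs iht | eq s t ihs iht | sub s t ihs iht | and s t ihs iht
  | or s t ihs iht | imp s t ihs iht =>
    obtain ⟨n, h1, h2, -⟩ := key ihs iht
    exact ⟨n, h1, h2⟩
  | sep s A ihs ihA =>
    obtain ⟨n, h1, -, -, h2⟩ := key ihs ihA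
    exact ⟨n, h1, h2⟩
  | repl t s iht ihs =>
    obtain ⟨n, -, h2, h1, -⟩ := key iht ihs
    exact ⟨n, h1, h2⟩
  | all A ih | ex A ih =>
    obtain ⟨n, h⟩ := ih
    exact ⟨n, h.mono (Nat.le_succ n)⟩

theorem subst_congr {k : Kind} {e : Expr k} {n : ℕ} (he : e.FreeBelow n) {f g : ℕ → Tm}
    (h : ∀ i < n, f i = g i) : subst f e = subst g e := by
  induction e generalizing n f g <;> simp only [FreeBelow] at he <;> simp only [subst]
  case var => exact h _ he
  all_goals
    have h' : ∀ i < n + 1, liftSub f i = liftSub g i := by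
      intro i hi
      cases i with
      | zero => rfl
      | succ i => exact congrArg up (h i (by omega))
    grind

theorem FreeBelow.subst {k : Kind} {e : Expr k} {m n : ℕ} (he : e.FreeBelow m) {f : ℕ → Tm}
    (h : ∀ i < m, (f i).FreeBelow n) : (e.subst f).FreeBelow n := by
  have hr : ∀ {k : Kind} {e : Expr k} {m n : ℕ} (_ : e.FreeBelow m) {r : ℕ → ℕ}
      (_ : ∀ i < m, r i < n), (e.rename r).FreeBelow n := by
    intro k e
    induction e <;> intro m n he r h <;> simp only [FreeBelow] at he <;>
      simp only [rename, FreeBelow]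
    case var => exact h _ he
    all_goals
      have h' : ∀ i < m + 1, liftRen r i < n + 1 := by
        intro i hi
        cases i with
        | zero => exact Nat.succ_pos n
        | succ i => exact Nat.succ_lt_succ (h i (by omega))
      grind
  induction e generalizing m n f <;> simp only [FreeBelow] at he <;>
    simp only [Expr.subst, FreeBelow]
  case var => exact h _ he
  all_goals
    have h' : ∀ i < m + 1, (liftSub f i).FreeBelow (n + 1) := by
      intro i hi
      cases i with
      | zero => exact Nat.succ_pos n
      | succ i => exact hr (h i (by omega)) (fun j hj => Nat.succ_lt_succ hj)
    grind

theorem FreeBelow.inst {k : Kind} {e : Expr k} {t : Tm} {n : ℕ} (he : e.FreeBelow 1)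
    (ht : t.FreeBelow n) : (e.inst t).FreeBelow n :=
  he.subst fun i hi => by
    obtain rfl : i = 0 := by omega
    exact ht

theorem rename_toEA1 (r : ℕ → ℕ) : ∀ A : Fm false, rename r (toEA1 A) = toEA1 (rename r A)
  | mem _ _ | eq _ _ | sub _ _ => by simp only [toEA1, rename]
  | neg A => by simp only [toEA1, rename, rename_toEA1 r A]
  | and A B | or A B | imp A B => by
    simp only [toEA1, rename, rename_toEA1 r A, rename_toEA1 r B]

end Expr

theorem EA0Axiom.rename {A : Fm false} (h : EA0Axiom A) (r : ℕ → ℕ) : EA0Axiom (A.rename r) := by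
  cases h with
  | emptySet a => exact .emptySet _
  | pairSet a s t => exact .pairSet _ _ _
  | powerSet a s => exact .powerSet _ _
  | unionSet a s =>
    simpa [iff, bex, ball, Expr.rename, rename_up, liftRen] using
      EA0Axiom.unionSet (a.rename r) (s.rename r)
  | subsetSelection a s A =>
    simpa [iff, Expr.rename, rename_inst] using
      EA0Axiom.subsetSelection (a.rename r) (s.rename r) (A.rename (liftRen r))
  | replacement a s t =>
    simpa [iff, bex, ball, Expr.rename, rename_up, liftRen] using
      EA0Axiom.replacement (a.rename r) (s.rename r) (t.rename (liftRen r))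
  | subsetElim a s t => exact .subsetElim _ _ _
  | extensionality s t => exact .extensionality _ _
  | dedekindFiniteness s t =>
    simpa [ssub, clt, cle, ceq, isFun, isInj, isSurj, prod, opair, single, bex, ball, Expr.rename,
      rename_up, liftRen] using EA0Axiom.dedekindFiniteness (s.rename r) (t.rename r)
  | epsilonFan a s =>
    simpa [iff, isChain, isLinOrd, first, last, next, ltOrd, field, cup, single, bex, ball,
      Expr.rename, rename_up, liftRen] using EA0Axiom.epsilonFan (a.rename r) (s.rename r)
  | foundation s t =>
    simpa [tc, field, Expr.rename, liftRen] using EA0Axiom.foundation (s.rename r) (t.rename r)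

namespace Derives

theorem weaken {H H' : List (Fm true)} {A : Fm true} (h : Derives H A) (hH : H ⊆ H') :
    Derives H' A := by
  induction h generalizing H' with
  | hyp h => exact .hyp (hH h)
  | ax h => exact .ax h
  | subIntro _ ih => exact .subIntro (ih (List.map_subset _ hH))
  | andIntro _ _ ih₁ ih₂ => exact .andIntro (ih₁ hH) (ih₂ hH)
  | andLeft _ ih => exact .andLeft (ih hH)
  | andRight _ ih => exact .andRight (ih hH)
  | orLeft _ ih => exact .orLeft (ih hH)
  | orRight _ ih => exact .orRight (ih hH)
  | orElim _ _ _ ih₁ ih₂ ih₃ =>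
    exact .orElim (ih₁ hH) (ih₂ (List.cons_subset_cons _ hH)) (ih₃ (List.cons_subset_cons _ hH))
  | impIntro _ ih => exact .impIntro (ih (List.cons_subset_cons _ hH))
  | impElim _ _ ih₁ ih₂ => exact .impElim (ih₁ hH) (ih₂ hH)
  | negIntro _ _ ih₁ ih₂ =>
    exact .negIntro (ih₁ (List.cons_subset_cons _ hH)) (ih₂ (List.cons_subset_cons _ hH))
  | negNeg _ ih => exact .negNeg (ih hH)
  | allIntro _ ih => exact .allIntro (ih (List.map_subset _ hH))
  | allElim t _ ih => exact .allElim t (ih hH)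
  | exIntro t _ ih => exact .exIntro t (ih hH)
  | exElim _ _ ih₁ ih₂ =>
    exact .exElim (ih₁ hH) (ih₂ (List.cons_subset_cons _ (List.map_subset _ hH)))
  | eqRefl t => exact .eqRefl t
  | eqSubst A _ _ ih₁ ih₂ => exact .eqSubst A (ih₁ hH) (ih₂ hH)

theorem map_rename_map_up (H : List (Fm true)) (r : ℕ → ℕ) :
    (H.map up).map (Expr.rename (liftRen r)) = (H.map (Expr.rename r)).map up := by
  simp only [List.map_map]
  exact List.map_congr_left fun A _ => rename_up A r

theorem rename {H : List (Fm true)} {A : Fm true} (h : Derives H A) (r : ℕ → ℕ) :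
    Derives (H.map (Expr.rename r)) (A.rename r) := by
  induction h generalizing r with
  | hyp h => exact .hyp (List.mem_map_of_mem h)
  | ax h => rw [rename_toEA1]; exact .ax (h.rename r)
  | subIntro _ ih =>
    refine .subIntro ?_
    have := ih (liftRen r)
    rw [map_rename_map_up] at this
    simpa only [Expr.rename, rename_up, liftRen] using this
  | andIntro _ _ ih₁ ih₂ => exact .andIntro (ih₁ r) (ih₂ r)
  | andLeft _ ih => exact .andLeft (ih r)
  | andRight _ ih => exact .andRight (ih r)
  | orLeft _ ih => exact .orLeft (ih r)
  | orRight _ ih => exact .orRight (ih r)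
  | orElim _ _ _ ih₁ ih₂ ih₃ => exact .orElim (ih₁ r) (ih₂ r) (ih₃ r)
  | impIntro _ ih => exact .impIntro (ih r)
  | impElim _ _ ih₁ ih₂ => exact .impElim (ih₁ r) (ih₂ r)
  | negIntro _ _ ih₁ ih₂ => exact .negIntro (ih₁ r) (ih₂ r)
  | negNeg _ ih => exact .negNeg (ih r)
  | allIntro _ ih => exact .allIntro (by rw [← map_rename_map_up]; exact ih _)
  | allElim t _ ih => rw [rename_inst]; exact .allElim _ (ih r)
  | exIntro t _ ih => exact .exIntro (t.rename r) (by rw [← rename_inst]; exact ih r)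
  | exElim _ _ ih₁ ih₂ =>
    refine .exElim (ih₁ r) ?_
    rw [← map_rename_map_up, ← rename_up]; exact ih₂ _
  | eqRefl t => exact .eqRefl _
  | eqSubst A _ _ ih₁ ih₂ =>
    rw [rename_inst]
    exact .eqSubst _ (ih₁ r) (by rw [← rename_inst]; exact ih₂ r)

end Derives

/-! ### Structures and evaluation -/

/-- A structure for the language: a membership relation and an epsilon fan operation. All other
operations are determined by membership. The element `default` is the value of a term that should
denote a set which does not exist in the structure. -/
class SetStructure (M : Type) where
  /-- The membership relation. -/
  mem : M → M → Prop
  /-- The interpretation of the epsilon fan. -/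
  fan : M → M
  /-- An arbitrary element. -/
  default : M

infix:50 " ε " => SetStructure.mem

/-- Extension of an assignment by a value for the variable `0`. -/
def push {M : Type} (x : M) (v : ℕ → M) : ℕ → M
  | 0 => x
  | i + 1 => v i

infixr:67 " ∷ " => push

section push

variable {M : Type} (x : M) (v : ℕ → M)

@[simp] theorem push_zero : (x ∷ v) 0 = x := rfl
@[simp] theorem push_succ (i : ℕ) : (x ∷ v) (i + 1) = v i := rfl
@[simp] theorem push_one : (x ∷ v) 1 = v 0 := rfl
@[simp] theorem push_two : (x ∷ v) 2 = v 1 := rfl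
@[simp] theorem push_three : (x ∷ v) 3 = v 2 := rfl
@[simp] theorem push_four : (x ∷ v) 4 = v 3 := rfl
@[simp] theorem push_five : (x ∷ v) 5 = v 4 := rfl
@[simp] theorem push_six : (x ∷ v) 6 = v 5 := rfl
@[simp] theorem push_seven : (x ∷ v) 7 = v 6 := rfl

end push

section Eval

variable {M : Type} [SetStructure M]

open Classical in
/-- The set of the structure whose members are the elements with property `P`, if there is one. -/
noncomputable def theSet (P : M → Prop) : M :=
  if h : ∃ z, ∀ a, a ε z ↔ P a then h.choose else SetStructure.default

theorem mem_theSet {P : M → Prop} (h : ∃ z, ∀ a, a ε z ↔ P a) (a : M) : a ε theSet P ↔ P a := by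
  rw [theSet, dif_pos h]; exact h.choose_spec a

/-- The inclusion relation of the structure. -/
def Incl (a b : M) : Prop := ∀ x, x ε a → x ε b

/-- The empty set of the structure. -/
noncomputable def sEmpty : M := theSet fun _ => False
/-- The pair set `{a, b}`. -/
noncomputable def sPair (a b : M) : M := theSet fun x => x = a ∨ x = b
/-- The power set of `a`. -/
noncomputable def sPow (a : M) : M := theSet fun x => Incl x a
/-- The union of `a`. -/
noncomputable def sUnion (a : M) : M := theSet fun x => ∃ y, y ε a ∧ x ε y
/-- The set `{x ∈ a : P x}`. In a `BaseModel` it is sure to have the right members only if `P` is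
definable by a formula of `EA₀`. -/
noncomputable def sSep (a : M) (P : M → Prop) : M := theSet fun x => x ε a ∧ P x
/-- The set `{f x : x ∈ a}`. In a `BaseModel` it is sure to have the right members only if `f` is
definable by a term of `EA₀`. -/
noncomputable def sRepl (a : M) (f : M → M) : M := theSet fun x => ∃ y, y ε a ∧ x = f y

/-- Terms are evaluated to elements and formulas to propositions. -/
abbrev Val (M : Type) : Kind → Type
  | Kind.term => M
  | Kind.formula _ => Prop

/-- The value of an expression under an assignment. -/
noncomputable def eval : {k : Kind} → (ℕ → M) → Expr k → Val M k
  | _, v, var i => v i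
  | _, _, empty => sEmpty (M := M)
  | _, v, pair s t => sPair (M := M) (eval v s) (eval v t)
  | _, v, pow s => sPow (M := M) (eval v s)
  | _, v, union s => sUnion (M := M) (eval v s)
  | _, v, fan s => SetStructure.fan (M := M) (eval v s)
  | _, v, sep s A => sSep (M := M) (eval v s) fun x => eval (x ∷ v) A
  | _, v, repl t s => sRepl (M := M) (eval v s) fun x => eval (x ∷ v) t
  | _, v, mem s t => SetStructure.mem (M := M) (eval v s) (eval v t)
  | _, v, eq s t => (eval v s : M) = eval v t
  | _, v, sub s t => Incl (M := M) (eval v s) (eval v t)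
  | _, v, neg A => ¬ eval v A
  | _, v, Expr.and A B => eval v A ∧ eval v B
  | _, v, Expr.or A B => eval v A ∨ eval v B
  | _, v, imp A B => eval v A → eval v B
  | _, v, all A => ∀ x : M, eval (x ∷ v) A
  | _, v, ex A => ∃ x : M, eval (x ∷ v) A

/-- The value of a term. -/
noncomputable def tv (v : ℕ → M) (t : Tm) : M := eval v t

/-- The truth of a formula. -/
def tr {b : Bool} (v : ℕ → M) (A : Fm b) : Prop := eval v A

variable (v : ℕ → M) (s t : Tm) {b : Bool} (A B : Fm b) (C : Fm true) (D : Fm false)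

@[simp] theorem tv_var (i : ℕ) : tv v (var i) = v i := rfl
@[simp] theorem tv_empty : tv v empty = sEmpty := rfl
@[simp] theorem tv_pair : tv v (pair s t) = sPair (tv v s) (tv v t) := rfl
@[simp] theorem tv_pow : tv v (pow s) = sPow (tv v s) := rfl
@[simp] theorem tv_union : tv v (union s) = sUnion (tv v s) := rfl
@[simp] theorem tv_fan : tv v (fan s) = SetStructure.fan (tv v s) := rfl
theorem tv_sep : tv v (sep s D) = sSep (tv v s) fun x => tr (x ∷ v) D := rfl
theorem tv_repl : tv v (repl t s) = sRepl (tv v s) fun x => tv (x ∷ v) t := rfl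
@[simp] theorem tr_mem : tr v (mem s t : Fm b) ↔ tv v s ε tv v t := Iff.rfl
@[simp] theorem tr_eq : tr v (eq s t : Fm b) ↔ tv v s = tv v t := Iff.rfl
@[simp] theorem tr_sub : tr v (sub s t : Fm b) ↔ Incl (tv v s) (tv v t) := Iff.rfl
@[simp] theorem tr_neg : tr v (neg A) ↔ ¬ tr v A := Iff.rfl
@[simp] theorem tr_and : tr v (and A B) ↔ tr v A ∧ tr v B := Iff.rfl
@[simp] theorem tr_or : tr v (or A B) ↔ tr v A ∨ tr v B := Iff.rfl
@[simp] theorem tr_imp : tr v (imp A B) ↔ (tr v A → tr v B) := Iff.rfl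
@[simp] theorem tr_all : tr v (all C) ↔ ∀ x, tr (x ∷ v) C := Iff.rfl
@[simp] theorem tr_ex : tr v (ex C) ↔ ∃ x, tr (x ∷ v) C := Iff.rfl
@[simp] theorem tr_iff : tr v (iff A B) ↔ (tr v A ↔ tr v B) := by
  simp [iff, iff_def]

theorem tr_toEA1 (v : ℕ → M) : ∀ A : Fm false, tr v A.toEA1 ↔ tr v A
  | mem _ _ | eq _ _ | sub _ _ => by simp [toEA1]
  | neg A => by simp [toEA1, tr_toEA1 v A]
  | Expr.and A B | Expr.or A B | imp A B => by simp [toEA1, tr_toEA1 v A, tr_toEA1 v B]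

theorem push_liftRen (r : ℕ → ℕ) (x : M) :
    (fun i => (x ∷ v) (liftRen r i)) = x ∷ fun i => v (r i) := by
  funext i; cases i <;> rfl

theorem eval_rename {k : Kind} (e : Expr k) (v : ℕ → M) (r : ℕ → ℕ) :
    eval v (rename r e) = eval (fun i => v (r i)) e := by
  induction e generalizing v r <;> simp [rename, eval, *, push_liftRen]

theorem eval_up {k : Kind} (e : Expr k) (v : ℕ → M) (x : M) : eval (x ∷ v) (up e) = eval v e :=
  eval_rename e _ _

theorem eval_liftSub (f : ℕ → Tm) (x : M) :
    (fun i => (eval (x ∷ v) (liftSub f i) : M)) = x ∷ fun i => eval v (f i) := by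
  funext i
  cases i with
  | zero => rfl
  | succ i => exact eval_up (f i) v x

theorem eval_subst {k : Kind} (e : Expr k) (v : ℕ → M) (f : ℕ → Tm) :
    eval v (subst f e) = eval (fun i => eval v (f i)) e := by
  induction e generalizing v f <;> simp [subst, eval, *, eval_liftSub]

theorem eval_inst {k : Kind} (e : Expr k) (t : Tm) : eval v (e.inst t) = eval (tv v t ∷ v) e := by
  rw [inst, eval_subst]; congr 1; funext i; cases i <;> rfl

@[simp] theorem tv_up (x : M) : tv (x ∷ v) t.up = tv v t := eval_up t v x
@[simp] theorem tr_up (x : M) : tr (x ∷ v) A.up ↔ tr v A := iff_of_eq (eval_up A v x)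
@[simp] theorem tv_inst : tv v (s.inst t) = tv (tv v t ∷ v) s := eval_inst v s t
@[simp] theorem tr_inst : tr v (A.inst t) ↔ tr (tv v t ∷ v) A := iff_of_eq (eval_inst v A t)
@[simp] theorem tv_inst₂ (e : Tm) : tv v (e.inst₂ s t) = tv (tv v s ∷ tv v t ∷ v) e := by
  rw [inst₂, tv, eval_subst]; congr 1; funext i
  rcases i with _ | _ | i <;> rfl

/-- Soundness: derivations preserve truth in structures that satisfy the axioms. -/
theorem Derives.sound (hM : ∀ A, EA0Axiom A → ∀ v : ℕ → M, tr v A) {H : List (Fm true)}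
    {A : Fm true} (h : Derives H A) (v : ℕ → M) (hH : ∀ B ∈ H, tr v B) : tr v A := by
  have up : ∀ {H : List (Fm true)} {v : ℕ → M} (x : M), (∀ B ∈ H, tr v B) →
      ∀ B ∈ H.map up, tr (x ∷ v) B := by
    intro H v x h B hB
    obtain ⟨C, hC, rfl⟩ := List.mem_map.1 hB
    exact (tr_up v C x).2 (h C hC)
  have cons : ∀ {H : List (Fm true)} {v : ℕ → M} {A : Fm true}, (∀ B ∈ H, tr v B) → tr v A →
      ∀ B ∈ A :: H, tr v B := fun h hA B hB => by
    rcases List.mem_cons.1 hB with rfl | hB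
    exacts [hA, h B hB]
  induction h generalizing v with
  | hyp h => exact hH _ h
  | ax h => exact (tr_toEA1 v _).2 (hM _ h v)
  | subIntro _ ih =>
    intro x hx
    have h := ih (x ∷ v) (up x hH)
    simp only [tr_imp, tr_mem, tv_var, push_zero, tv_up] at h
    exact h hx
  | andIntro _ _ ih₁ ih₂ => exact ⟨ih₁ v hH, ih₂ v hH⟩
  | andLeft _ ih => exact (ih v hH).1
  | andRight _ ih => exact (ih v hH).2
  | orLeft _ ih => exact Or.inl (ih v hH)
  | orRight _ ih => exact Or.inr (ih v hH)
  | orElim _ _ _ ih₁ ih₂ ih₃ =>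
    exact (ih₁ v hH).elim (fun h => ih₂ v (cons hH h)) (fun h => ih₃ v (cons hH h))
  | impIntro _ ih => exact fun h => ih v (cons hH h)
  | impElim _ _ ih₁ ih₂ => exact ih₁ v hH (ih₂ v hH)
  | negIntro _ _ ih₁ ih₂ => exact fun h => ih₂ v (cons hH h) (ih₁ v (cons hH h))
  | negNeg _ ih => exact not_not.1 (ih v hH)
  | allIntro _ ih => exact fun x => ih (x ∷ v) (up x hH)
  | allElim t _ ih => exact (tr_inst ..).2 (ih v hH _)
  | exIntro t _ ih => exact ⟨tv v t, (tr_inst ..).1 (ih v hH)⟩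
  | exElim _ _ ih₁ ih₂ =>
    obtain ⟨x, hx⟩ := ih₁ v hH
    exact (tr_up ..).1 (ih₂ (x ∷ v) (cons (up x hH) hx))
  | eqRefl t => rfl
  | eqSubst A _ _ ih₁ ih₂ =>
    have h := (tr_inst ..).1 (ih₂ v hH)
    rw [show tv v _ = tv v _ from ih₁ v hH] at h
    exact (tr_inst ..).2 h

end Eval

/-! ### Basic set theory in a structure -/

/-- An extensional structure in which the sets denoted by the terms exist. -/
class BaseModel (M : Type) [SetStructure M] : Prop where
  ext : ∀ a b : M, (∀ x, x ε a ↔ x ε b) → a = b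
  exists_empty : ∃ z : M, ∀ x, ¬ x ε z
  exists_pair : ∀ a b : M, ∃ z, ∀ x, x ε z ↔ x = a ∨ x = b
  exists_pow : ∀ a : M, ∃ z, ∀ x, x ε z ↔ Incl x a
  exists_union : ∀ a : M, ∃ z, ∀ x, x ε z ↔ ∃ y, y ε a ∧ x ε y
  exists_sep : ∀ (a : M) (A : Fm false) (v : ℕ → M), ∃ z, ∀ x, x ε z ↔ x ε a ∧ tr (x ∷ v) A
  exists_repl : ∀ (a : M) (t : Tm) (v : ℕ → M), ∃ z, ∀ x, x ε z ↔ ∃ y, y ε a ∧ x = tv (y ∷ v) t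

section Base

variable {M : Type} [SetStructure M] [BaseModel M] {a b c d x y : M}

open BaseModel

theorem Incl.refl (a : M) : Incl a a := fun _ h => h
theorem Incl.trans (h : Incl a b) (h' : Incl b c) : Incl a c := fun x hx => h' x (h x hx)
theorem Incl.antisymm (h : Incl a b) (h' : Incl b a) : a = b := ext _ _ fun x => ⟨h x, h' x⟩

@[simp] theorem not_mem_sEmpty : ¬ x ε (sEmpty : M) := by
  rw [sEmpty, mem_theSet]
  · exact id
  · simpa using exists_empty

@[simp] theorem mem_sPair : x ε sPair a b ↔ x = a ∨ x = b := mem_theSet (exists_pair a b) x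
@[simp] theorem mem_sPow : x ε sPow a ↔ Incl x a := mem_theSet (exists_pow a) x
@[simp] theorem mem_sUnion : x ε sUnion a ↔ ∃ y, y ε a ∧ x ε y := mem_theSet (exists_union a) x

@[simp] theorem mem_tv_sep (v : ℕ → M) (s : Tm) (A : Fm false) :
    x ε tv v (sep s A) ↔ x ε tv v s ∧ tr (x ∷ v) A :=
  mem_theSet (exists_sep (tv v s) A v) x

@[simp] theorem mem_tv_repl (v : ℕ → M) (s t : Tm) :
    x ε tv v (repl t s) ↔ ∃ y, y ε tv v s ∧ x = tv (y ∷ v) t :=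
  mem_theSet (exists_repl (tv v s) t v) x

@[simp] theorem tr_ball {b : Bool} (v : ℕ → M) (s : Tm) (A : Fm false) :
    tr v (ball s A : Fm b) ↔ ∀ x, x ε tv v s → tr (x ∷ v) A := by
  simp +contextual [ball, Incl]

@[simp] theorem tr_bex {b : Bool} (v : ℕ → M) (s : Tm) (A : Fm false) :
    tr v (bex s A : Fm b) ↔ ∃ x, x ε tv v s ∧ tr (x ∷ v) A := by
  simp [bex]

/-- `{a}`. -/
noncomputable def sSingle (a : M) : M := sPair a a

@[simp] theorem mem_sSingle : x ε sSingle a ↔ x = a := by simp [sSingle]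

@[simp] theorem tv_single (v : ℕ → M) (s : Tm) : tv v (single s) = sSingle (tv v s) := rfl

/-- `a ∪ b`. -/
noncomputable def sCup (a b : M) : M := sUnion (sPair a b)

@[simp] theorem mem_sCup : x ε sCup a b ↔ x ε a ∨ x ε b := by simp [sCup]

@[simp] theorem tv_cup (v : ℕ → M) (s t : Tm) : tv v (cup s t) = sCup (tv v s) (tv v t) := rfl

theorem ssub_iff (v : ℕ → M) (s t : Tm) {k : Bool} :
    tr v (ssub s t : Fm k) ↔ Incl (tv v s) (tv v t) ∧ tv v s ≠ tv v t := by
  simp [ssub]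

theorem sPair_inj : sPair a b = sPair c d ↔ (a = c ∧ b = d) ∨ (a = d ∧ b = c) := by
  constructor
  · intro h
    have h1 : ∀ x, (x = a ∨ x = b) ↔ (x = c ∨ x = d) := fun x => by rw [← mem_sPair, h, mem_sPair]
    have ha := (h1 a).1 (Or.inl rfl)
    have hb := (h1 b).1 (Or.inr rfl)
    have hc := (h1 c).2 (Or.inl rfl)
    have hd := (h1 d).2 (Or.inr rfl)
    grind
  · rintro (⟨rfl, rfl⟩ | ⟨rfl, rfl⟩)
    · rfl
    · exact ext _ _ fun x => by simp [or_comm]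

/-- The Kuratowski pair. -/
noncomputable def sOpair (a b : M) : M := sPair (sSingle a) (sPair a b)

@[simp] theorem tv_opair (v : ℕ → M) (s t : Tm) : tv v (opair s t) = sOpair (tv v s) (tv v t) := rfl

@[simp] theorem sOpair_inj : sOpair a b = sOpair c d ↔ a = c ∧ b = d := by
  rw [sOpair, sOpair, sSingle, sSingle, sPair_inj, sPair_inj, sPair_inj, sPair_inj, sPair_inj]
  grind

/-- `a × b`. -/
noncomputable def sProd (a b : M) : M := tv (a ∷ b ∷ fun _ => a) (prod (var 0) (var 1))

@[simp] theorem mem_tv_prod (v : ℕ → M) (s t : Tm) :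
    x ε tv v (prod s t) ↔ ∃ p q, p ε tv v s ∧ q ε tv v t ∧ x = sOpair p q := by
  simp only [prod, tv_union, mem_sUnion, mem_tv_repl]
  constructor
  · rintro ⟨_, ⟨p, hp, rfl⟩, hx⟩
    simp only [mem_tv_repl, tv_up, tv_opair, tv_var, push_one, push_zero] at hx
    obtain ⟨q, hq, rfl⟩ := hx
    exact ⟨p, q, hp, hq, rfl⟩
  · rintro ⟨p, q, hp, hq, rfl⟩
    exact ⟨_, ⟨p, hp, rfl⟩, (mem_tv_repl ..).2 ⟨q, by simpa using hq, by simp⟩⟩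

@[simp] theorem mem_sProd : x ε sProd a b ↔ ∃ p q, p ε a ∧ q ε b ∧ x = sOpair p q := by
  simp [sProd]

@[simp] theorem tv_prod (v : ℕ → M) (s t : Tm) : tv v (prod s t) = sProd (tv v s) (tv v t) :=
  ext _ _ fun x => by simp

/-- Comprehension for binary relations between the members of two sets. In `A` the variables
`0`, `1` stand for the second and the first argument, `2` for their ordered pair, `3` and `4` for
the two sets, and the following ones for parameters. -/
theorem exists_rel (a b : M) (A : Fm false) (v : ℕ → M) :
    ∃ f : M, ∀ x y, sOpair x y ε f ↔
      x ε a ∧ y ε b ∧ tr (y ∷ x ∷ sOpair x y ∷ a ∷ b ∷ v) A := by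
  refine ⟨tv (a ∷ b ∷ v) (sep (prod (var 0) (var 1))
    (bex (var 1) (bex (var 3) (and (eq (var 2) (opair (var 1) (var 0))) A)))), fun x y => ?_⟩
  simp only [mem_tv_sep, tr_bex, tv_var, tr_and, tr_eq, tv_opair, push_zero, push_one, push_two,
    push_three, tv_prod, mem_sProd]
  constructor
  · rintro ⟨-, x', hx, y', hy, he, h⟩
    obtain ⟨rfl, rfl⟩ := sOpair_inj.1 he
    exact ⟨hx, hy, h⟩
  · rintro ⟨hx, hy, h⟩
    exact ⟨⟨x, y, hx, hy, rfl⟩, x, hx, y, hy, rfl, h⟩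

/-- The set `f` of ordered pairs is the graph of an injection of `a` into `b`, apart from pairs
that do not belong to `a × b`. -/
structure IsInjection (f a b : M) : Prop where
  total : ∀ x, x ε a → ∃ y, y ε b ∧ sOpair x y ε f
  functional : ∀ x y y', x ε a → y ε b → y' ε b → sOpair x y ε f → sOpair x y' ε f → y = y'
  injective : ∀ x x' y, x ε a → x' ε a → y ε b → sOpair x y ε f → sOpair x' y ε f → x = x'

/-- `a ≤_c b`. -/
def Cle (a b : M) : Prop := ∃ f, IsInjection f a b

/-- `a ≃_c b`. -/
def Ceq (a b : M) : Prop := ∃ f, IsInjection f a b ∧ ∀ y, y ε b → ∃ x, x ε a ∧ sOpair x y ε f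

theorem isFun_isInj_iff (v : ℕ → M) (s t : Tm) (f : M) :
    (tr (f ∷ v) (isFun (var 0) s.up t.up : Fm false) ∧
      tr (f ∷ v) (isInj (var 0) s.up t.up : Fm false)) ↔
    Incl f (sProd (tv v s) (tv v t)) ∧ IsInjection f (tv v s) (tv v t) := by
  simp only [isFun, isInj, tr_and, tr_sub, tr_ball, tr_bex, tr_imp, tr_mem, tr_eq, tv_up, tv_var,
    tv_opair, push_zero, push_one, push_two, tv_prod]
  constructor
  · rintro ⟨⟨h1, h2⟩, h3⟩
    refine ⟨h1, ⟨fun x hx => ?_, fun x y y' hx hy hy' h h' => ?_, fun x x' y hx hx' hy h h' => ?_⟩⟩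
    · obtain ⟨y, hy, h, -⟩ := h2 x hx
      exact ⟨y, hy, h⟩
    · obtain ⟨z, -, -, hz⟩ := h2 x hx
      rw [hz y hy h, hz y' hy' h']
    · exact h3 x hx x' hx' y hy ⟨h, h'⟩
  · rintro ⟨h1, h2, h3, h4⟩
    refine ⟨⟨h1, fun x hx => ?_⟩, fun x hx x' hx' y hy h => h4 x x' y hx hx' hy h.1 h.2⟩
    obtain ⟨y, hy, h⟩ := h2 x hx
    exact ⟨y, hy, h, fun z hz h' => h3 x z y hx hz hy h' h⟩

/-- The pairs of `f` that lie in `a × b`. -/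
theorem exists_restrict (f a b : M) :
    ∃ g : M, Incl g (sProd a b) ∧ ∀ x y, x ε a → y ε b → (sOpair x y ε g ↔ sOpair x y ε f) := by
  refine ⟨tv (f ∷ a ∷ b ∷ fun _ => a) (sep (prod (var 1) (var 2)) (mem (var 0) (var 1))),
    fun x hx => ?_, fun x y hx hy => ?_⟩
  · rw [mem_tv_sep] at hx
    simpa using hx.1
  · simp only [mem_tv_sep, tv_prod, mem_sProd, tr_mem, tv_var, push_zero, push_one, push_two,
      and_iff_right_iff_imp]
    exact fun _ => ⟨x, y, hx, hy, rfl⟩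

theorem IsInjection.congr {f g : M} (h : IsInjection f a b)
    (hg : ∀ x y, x ε a → y ε b → (sOpair x y ε g ↔ sOpair x y ε f)) : IsInjection g a b where
  total x hx := by
    obtain ⟨y, hy, h⟩ := h.total x hx
    exact ⟨y, hy, (hg x y hx hy).2 h⟩
  functional x y y' hx hy hy' h1 h2 :=
    h.functional x y y' hx hy hy' ((hg x y hx hy).1 h1) ((hg x y' hx hy').1 h2)
  injective x x' y hx hx' hy h1 h2 :=
    h.injective x x' y hx hx' hy ((hg x y hx hy).1 h1) ((hg x' y hx' hy).1 h2)

@[simp] theorem tr_cle {k : Bool} (v : ℕ → M) (s t : Tm) :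
    tr v (cle s t : Fm k) ↔ Cle (tv v s) (tv v t) := by
  rw [cle, tr_bex, Cle]
  simp only [tr_and, isFun_isInj_iff, tv_pow, mem_sPow, tv_prod]
  constructor
  · rintro ⟨f, -, -, h⟩
    exact ⟨f, h⟩
  · rintro ⟨f, h⟩
    obtain ⟨g, hg, hg'⟩ := exists_restrict f (tv v s) (tv v t)
    exact ⟨g, hg, hg, h.congr hg'⟩

@[simp] theorem tr_ceq {k : Bool} (v : ℕ → M) (s t : Tm) :
    tr v (ceq s t : Fm k) ↔ Ceq (tv v s) (tv v t) := by
  rw [ceq, tr_bex, Ceq]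
  simp only [tr_and, ← and_assoc]
  simp only [and_assoc (b := tr _ (isFun _ _ _)), isFun_isInj_iff, tv_pow, mem_sPow, tv_prod]
  simp only [isSurj, tr_ball, tr_bex, tv_up, tr_mem, tv_opair, tv_var, push_zero, push_one]
  constructor
  · rintro ⟨f, ⟨-, -, h⟩, h'⟩
    exact ⟨f, h, h'⟩
  · rintro ⟨f, h, h'⟩
    obtain ⟨g, hg, hg'⟩ := exists_restrict f (tv v s) (tv v t)
    refine ⟨g, ⟨hg, hg, h.congr hg'⟩, fun y hy => ?_⟩
    obtain ⟨x, hx, hxy⟩ := h' y hy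
    exact ⟨x, hx, (hg' x y hx hy).2 hxy⟩

@[simp] theorem tr_clt {k : Bool} (v : ℕ → M) (s t : Tm) :
    tr v (clt s t : Fm k) ↔ Cle (tv v s) (tv v t) ∧ ¬ Ceq (tv v s) (tv v t) := by
  simp [clt]

theorem Ceq.cle (h : Ceq a b) : Cle a b :=
  let ⟨f, hf, _⟩ := h
  ⟨f, hf⟩

theorem Cle.of_sub (h : Incl a b) : Cle a b := by
  obtain ⟨f, hf⟩ := exists_rel a b (eq (var 0) (var 1)) (fun _ => a)
  simp only [tr_eq, tv_var, push_zero, push_one] at hf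
  refine ⟨f, fun x hx => ⟨x, h x hx, ?_⟩, fun x y y' _ _ _ h1 h2 => ?_,
    fun x x' y _ _ _ h1 h2 => ?_⟩
  · simp [hf, hx, h x hx]
  · rw [((hf _ _).1 h1).2.2, ((hf _ _).1 h2).2.2]
  · rw [← ((hf _ _).1 h1).2.2, ← ((hf _ _).1 h2).2.2]

theorem Ceq.symm (h : Ceq a b) : Ceq b a := by
  obtain ⟨f, hf, hs⟩ := h
  obtain ⟨g, hg⟩ := exists_rel b a (mem (opair (var 0) (var 1)) (var 5)) (fun _ => f)
  simp only [tr_mem, tv_opair, tv_var, push_zero, push_one, push_five, push_four, push_three,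
    push_two] at hg
  refine ⟨g, ⟨fun y hy => ?_, fun y x x' hy hx hx' h1 h2 => ?_, fun y y' x hy hy' hx h1 h2 => ?_⟩,
    fun x hx => ?_⟩
  · obtain ⟨x, hx, h⟩ := hs y hy
    exact ⟨x, hx, (hg y x).2 ⟨hy, hx, h⟩⟩
  · exact hf.injective x x' y hx hx' hy ((hg _ _).1 h1).2.2 ((hg _ _).1 h2).2.2
  · exact hf.functional x y y' hx hy hy' ((hg _ _).1 h1).2.2 ((hg _ _).1 h2).2.2
  · obtain ⟨y, hy, h⟩ := hf.total x hx
    exact ⟨y, hy, (hg _ _).2 ⟨hy, hx, h⟩⟩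

theorem IsInjection.exists_comp {f g : M} (hf : IsInjection f a b) (hg : IsInjection g b c) :
    ∃ h, IsInjection h a c ∧
      ∀ x y z, x ε a → y ε b → z ε c → sOpair x y ε f → sOpair y z ε g → sOpair x z ε h := by
  obtain ⟨h, hh⟩ := exists_rel a c (bex (var 7) (and (mem (opair (var 2) (var 0)) (var 6))
    (mem (opair (var 0) (var 1)) (var 7)))) (f ∷ g ∷ fun _ => b)
  simp only [tr_mem, tv_opair, tv_var, push_zero, push_one, push_five, push_four, push_three,
    push_two, push_six, push_seven, tr_bex, tr_and] at hh
  refine ⟨h, ⟨fun x hx => ?_, fun x z z' hx hz hz' h1 h2 => ?_, fun x x' z hx hx' hz h1 h2 => ?_⟩,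
    fun x y z hx hy hz h1 h2 => (hh x z).2 ⟨hx, hz, y, hy, h1, h2⟩⟩
  · obtain ⟨y, hy, h1⟩ := hf.total x hx
    obtain ⟨z, hz, h2⟩ := hg.total y hy
    exact ⟨z, hz, (hh x z).2 ⟨hx, hz, y, hy, h1, h2⟩⟩
  · obtain ⟨-, -, y, hy, h3, h4⟩ := (hh x z).1 h1
    obtain ⟨-, -, y', hy', h5, h6⟩ := (hh x z').1 h2
    obtain rfl := hf.functional x y y' hx hy hy' h3 h5
    exact hg.functional y z z' hy hz hz' h4 h6
  · obtain ⟨-, -, y, hy, h3, h4⟩ := (hh x z).1 h1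
    obtain ⟨-, -, y', hy', h5, h6⟩ := (hh x' z).1 h2
    obtain rfl := hg.injective y y' z hy hy' hz h4 h6
    exact hf.injective x x' y hx hx' hy h3 h5

theorem Cle.trans (h : Cle a b) (h' : Cle b c) : Cle a c := by
  obtain ⟨f, hf⟩ := h
  obtain ⟨g, hg⟩ := h'
  obtain ⟨h, hh, -⟩ := hf.exists_comp hg
  exact ⟨h, hh⟩

theorem Ceq.trans (h : Ceq a b) (h' : Ceq b c) : Ceq a c := by
  obtain ⟨f, hf, hsf⟩ := h
  obtain ⟨g, hg, hsg⟩ := h'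
  obtain ⟨h, hh, hc⟩ := hf.exists_comp hg
  refine ⟨h, hh, fun z hz => ?_⟩
  obtain ⟨y, hy, h1⟩ := hsg z hz
  obtain ⟨x, hx, h2⟩ := hsf y hy
  exact ⟨x, hx, hc x y z hx hy hz h2 h1⟩

end Base

open BaseModel

/-! ### Linear orderings -/

section LinearOrderings

variable {M : Type} [SetStructure M] [BaseModel M] {L W V X x y z a : M}

/-- `W ∪ {y}`. -/
noncomputable def sIns (W y : M) : M := sCup W (sSingle y)

@[simp] theorem mem_sIns : x ε sIns W y ↔ x ε W ∨ x = y := by simp [sIns]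

theorem incl_sIns (W y : M) : Incl W (sIns W y) := fun _ h => mem_sIns.2 (Or.inl h)

theorem self_mem_sIns (W y : M) : y ε sIns W y := mem_sIns.2 (Or.inr rfl)

theorem eq_empty_iff : a = sEmpty ↔ ∀ x, ¬ x ε a := by
  constructor
  · rintro rfl x
    exact not_mem_sEmpty
  · exact fun h => ext _ _ fun x => by simp [h]

theorem ne_empty_iff : a ≠ sEmpty ↔ ∃ x, x ε a := by
  rw [Ne, eq_empty_iff]; push Not; rfl

/-- `L` codes a linear ordering: it is the set of the non-empty initial segments. -/
structure LinOrd (L : M) : Prop where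
  nonempty : ∀ W, W ε L → ∃ x, x ε W
  first : (∃ W, W ε L) → ∃ a, sSingle a ε L
  step : ∀ W, W ε L → W = sUnion L ∨ ∃ y, y ε sUnion L ∧ ¬ y ε W ∧ sIns W y ε L
  total : ∀ V W, V ε L → W ε L → Incl V W ∨ Incl W V

@[simp] theorem tr_isLinOrd {b : Bool} (v : ℕ → M) (t : Tm) :
    tr v (isLinOrd t : Fm b) ↔ LinOrd (tv v t) := by
  simp only [isLinOrd, tr_and, tr_neg, tr_mem, tv_empty, tr_imp, tr_eq, tr_bex, tr_or, tr_ball,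
    tv_var, push_zero, push_one, tv_single, tv_cup, tv_up, tv_union, tr_sub]
  constructor
  · rintro ⟨h1, h2, h3, h4⟩
    refine ⟨fun W hW => ?_, fun h => ?_, fun W hW => ?_, fun V W hV hW => h4 V hV W hW⟩
    · exact ne_empty_iff.1 fun h => h1 (h ▸ hW)
    · obtain ⟨W, hW, a, -, rfl⟩ := h2 (ne_empty_iff.2 h)
      exact ⟨a, hW⟩
    · exact h3 W hW
  · rintro ⟨h1, h2, h3, h4⟩
    refine ⟨fun h => ?_, fun h => ?_, fun W hW => h3 W hW, fun V hV W hW => h4 V W hV hW⟩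
    · obtain ⟨x, hx⟩ := h1 _ h
      exact not_mem_sEmpty hx
    · obtain ⟨a, ha⟩ := h2 (ne_empty_iff.1 h)
      exact ⟨_, ha, a, by simp, rfl⟩

theorem linOrd_empty : LinOrd (sEmpty : M) := by
  constructor <;> simp

/-- `W` is the least initial segment of `L` that contains `y`; in other words, `y` is the last
element of the initial segment `W`. -/
structure Top (L W y : M) : Prop where
  seg_mem : W ε L
  mem : y ε W
  least : ∀ V, V ε L → y ε V → Incl W V

namespace Top

theorem seg_unique (h : Top L W y) (h' : Top L V y) : W = V :=
  (h.least V h'.seg_mem h'.mem).antisymm (h'.least W h.seg_mem h.mem)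

theorem mem_union (h : Top L W y) : y ε sUnion L := mem_sUnion.2 ⟨W, h.seg_mem, h.mem⟩

end Top

namespace LinOrd

theorem ins_unique (hL : LinOrd L) (hy : ¬ y ε W) (hz : ¬ z ε W) (hyL : sIns W y ε L)
    (hzL : sIns W z ε L) : y = z := by
  rcases hL.total _ _ hyL hzL with h | h
  · have := h y (self_mem_sIns ..)
    grind [mem_sIns]
  · have := h z (self_mem_sIns ..)
    grind [mem_sIns]

theorem ins_injective (hL : LinOrd L) (hW : W ε L) (hV : V ε L) (hy : ¬ y ε W) (hz : ¬ z ε V)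
    (h : sIns W y = sIns V z) : W = V := by
  have h' : ∀ x, (x ε W ∨ x = y) ↔ (x ε V ∨ x = z) := fun x => by
    rw [← mem_sIns, h, mem_sIns]
  have : y = z := by
    rcases hL.total _ _ hW hV with h1 | h1
    · have h2 := (h' z).2 (Or.inr rfl)
      grind [Incl]
    · have h2 := (h' y).1 (Or.inr rfl)
      grind [Incl]
  subst this
  refine ext _ _ fun x => ?_
  have := h' x
  grind

theorem single_incl (hL : LinOrd L) (hx : sSingle x ε L) (hW : W ε L) : Incl (sSingle x) W := by
  rcases hL.total _ _ hx hW with h | h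
  · exact h
  · obtain ⟨z, hz⟩ := hL.nonempty W hW
    have hzx := mem_sSingle.1 (h z hz)
    subst hzx
    intro y hy
    rwa [mem_sSingle.1 hy]

theorem top_single (hL : LinOrd L) (hx : sSingle x ε L) : Top L (sSingle x) x :=
  ⟨hx, by simp, fun _ hV _ => hL.single_incl hx hV⟩

theorem ins_incl (hL : LinOrd L) (hy : ¬ y ε W) (hW : W ε L) (hV : V ε L) (hyV : y ε V) :
    Incl (sIns W y) V := by
  intro x hx
  rcases mem_sIns.1 hx with hx | rfl
  · rcases hL.total _ _ hW hV with h | h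
    · exact h x hx
    · exact absurd (h y hyV) hy
  · exact hyV

theorem top_ins (hL : LinOrd L) (hW : W ε L) (hy : ¬ y ε W) (hyL : sIns W y ε L) :
    Top L (sIns W y) y :=
  ⟨hyL, self_mem_sIns .., fun _ hV hyV => hL.ins_incl hy hW hV hyV⟩

end LinOrd

/-- The property is defined by a formula of `EA₀` with parameters. -/
def Definable (P : M → Prop) : Prop := ∃ (A : Fm false) (v : ℕ → M), ∀ x, tr (x ∷ v) A ↔ P x

theorem Definable.exists_sep {P : M → Prop} (h : Definable P) (a : M) :
    ∃ z, ∀ x, x ε z ↔ x ε a ∧ P x := by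
  obtain ⟨A, v, h⟩ := h
  simpa only [h] using BaseModel.exists_sep a A v

/-- A structure in which, moreover, no set is equinumerous with a proper subset of itself. -/
class FiniteModel (M : Type) [SetStructure M] : Prop extends BaseModel M where
  dedekind : ∀ a b : M, Incl a b → Ceq a b → a = b

end LinearOrderings

section Induction

variable {M : Type} [SetStructure M] [FiniteModel M] {L W V X x y z a : M}

namespace LinOrd

/-- A set of initial segments that contains the first one has a member without an immediate
successor in the set: otherwise the successor operation would map the set injectively into the
set without the first initial segment, against Dedekind finiteness. -/
theorem not_closed (hL : LinOrd L) (hX : ∀ W, W ε X → W ε L) (ha : sSingle a ε X)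
    (hs : ∀ W, W ε X → ∃ y, ¬ y ε W ∧ sIns W y ε X) : False := by
  obtain ⟨Y, hY⟩ := Definable.exists_sep (a := X)
    (P := fun V => ∃ W, W ε X ∧ ∃ y, y ε V ∧ ¬ y ε W ∧ V = sIns W y)
    ⟨bex (var 1) (bex (var 1) (and (neg (mem (var 0) (var 1)))
      (eq (var 2) (cup (var 1) (single (var 0)))))), fun _ => X, fun V => by simp [sIns]⟩
  obtain ⟨f, hf⟩ := exists_rel X Y (bex (var 0) (and (neg (mem (var 0) (var 2)))
      (eq (var 1) (cup (var 2) (single (var 0)))))) (fun _ => X)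
  simp only [tr_bex, tr_and, tr_neg, tr_mem, tr_eq, tv_cup, tv_single, tv_var, push_zero,
    push_one, push_two] at hf
  change ∀ W V, sOpair W V ε f ↔ W ε X ∧ V ε Y ∧ ∃ y, y ε V ∧ ¬ y ε W ∧ V = sIns W y at hf
  have hYX : Incl Y X := fun V hV => ((hY V).1 hV).1
  have hce : Ceq X Y := by
    refine ⟨f, ⟨fun W hW => ?_, fun W V V' hW _ _ h1 h2 => ?_, fun W W' V hW hW' _ h1 h2 => ?_⟩,
      fun V hV => ?_⟩
    · obtain ⟨y, hy, hyX⟩ := hs W hW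
      have hyY : sIns W y ε Y := (hY _).2 ⟨hyX, W, hW, y, self_mem_sIns .., hy, rfl⟩
      exact ⟨_, hyY, (hf ..).2 ⟨hW, hyY, y, self_mem_sIns .., hy, rfl⟩⟩
    · obtain ⟨-, hV, y, -, hy, rfl⟩ := (hf ..).1 h1
      obtain ⟨-, hV', z, -, hz, rfl⟩ := (hf ..).1 h2
      rw [hL.ins_unique hy hz (hX _ (hYX _ hV)) (hX _ (hYX _ hV'))]
    · obtain ⟨-, -, y, -, hy, h⟩ := (hf ..).1 h1
      obtain ⟨-, -, z, -, hz, h'⟩ := (hf ..).1 h2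
      exact hL.ins_injective (hX _ hW) (hX _ hW') hy hz (h.symm.trans h')
    · obtain ⟨-, W, hW, y, hyV, hy, h⟩ := (hY V).1 hV
      exact ⟨W, hW, (hf ..).2 ⟨hW, hV, y, hyV, hy, h⟩⟩
  have hYX' : Y = X := FiniteModel.dedekind Y X hYX hce.symm
  rw [← hYX'] at ha
  obtain ⟨-, W, hW, y, hya, hy, h⟩ := (hY _).1 ha
  obtain ⟨x, hx⟩ := hL.nonempty W (hX W hW)
  have h1 : x ε sSingle a := h ▸ incl_sIns W y x hx
  rw [mem_sSingle] at h1 hya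
  exact hy (hya ▸ h1 ▸ hx)

/-- Induction along a linear ordering. -/
theorem induction (hL : LinOrd L) {P : M → Prop} (hP : Definable P)
    (h1 : ∀ a, sSingle a ε L → P (sSingle a))
    (h2 : ∀ W y, W ε L → P W → ¬ y ε W → sIns W y ε L → P (sIns W y)) {V : M} (hV : V ε L) :
    P V := by
  by_contra hPV
  obtain ⟨X, hX⟩ := hP.exists_sep L
  obtain ⟨Y, hY⟩ := Definable.exists_sep (a := X) (P := fun W => Incl W V)
    ⟨sub (var 0) (var 1), fun _ => V, fun W => by simp⟩
  obtain ⟨a, ha⟩ := hL.first ⟨V, hV⟩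
  refine hL.not_closed (X := Y) (a := a) (fun W hW => ((hX W).1 ((hY W).1 hW).1).1)
    ((hY _).2 ⟨(hX _).2 ⟨ha, h1 a ha⟩, hL.single_incl ha hV⟩) fun W hW => ?_
  obtain ⟨hWX, hWV⟩ := (hY W).1 hW
  obtain ⟨hWL, hPW⟩ := (hX W).1 hWX
  have hne : W ≠ V := fun h => hPV (h ▸ hPW)
  rcases hL.step W hWL with h | ⟨y, -, hy, hyL⟩
  · exact absurd (hWV.antisymm (h ▸ fun x hx => mem_sUnion.2 ⟨V, hV, hx⟩)) hne
  · refine ⟨y, hy, (hY _).2 ⟨(hX _).2 ⟨hyL, h2 W y hWL hPW hy hyL⟩, ?_⟩⟩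
    by_cases hyV : y ε V
    · exact hL.ins_incl hy hWL hV hyV
    · refine absurd (hWV.antisymm fun x hx => ?_) hne
      rcases hL.total _ _ hV hyL with h | h
      · rcases mem_sIns.1 (h x hx) with h | rfl
        exacts [h, absurd hx hyV]
      · exact absurd (h y (self_mem_sIns ..)) hyV

theorem union_mem (hL : LinOrd L) (h : ∃ W, W ε L) : sUnion L ε L := by
  by_contra hU
  obtain ⟨a, ha⟩ := hL.first h
  refine hL.not_closed (X := L) (fun _ h => h) ha fun W hW => ?_
  rcases hL.step W hW with h | ⟨y, -, hy, hyL⟩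
  exacts [absurd (h ▸ hW) hU, ⟨y, hy, hyL⟩]

theorem seg_cases (hL : LinOrd L) (hW : W ε L) :
    (∃ a, W = sSingle a) ∨ ∃ V y, V ε L ∧ ¬ y ε V ∧ W = sIns V y := by
  have := hL.induction (P := fun W => (∃ a, a ε W ∧ W = sSingle a) ∨
      ∃ V, V ε L ∧ ∃ y, y ε W ∧ ¬ y ε V ∧ W = sIns V y)
    ⟨or (bex (var 0) (eq (var 1) (single (var 0)))) (bex (var 1) (bex (var 1)
      (and (neg (mem (var 0) (var 1))) (eq (var 2) (cup (var 1) (single (var 0))))))),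
      fun _ => L, fun W => by simp [sIns]⟩
    (fun a _ => Or.inl ⟨a, by simp, rfl⟩)
    (fun W y hW _ hy _ => Or.inr ⟨W, hW, y, self_mem_sIns .., hy, rfl⟩) hW
  rcases this with ⟨a, -, h⟩ | ⟨V, hV, y, -, hy, h⟩
  exacts [Or.inl ⟨a, h⟩, Or.inr ⟨V, y, hV, hy, h⟩]

theorem exists_top (hL : LinOrd L) (hW : W ε L) : ∃ y, Top L W y := by
  rcases hL.seg_cases hW with ⟨a, rfl⟩ | ⟨V, y, hV, hy, rfl⟩
  exacts [⟨a, hL.top_single hW⟩, ⟨y, hL.top_ins hV hy hW⟩]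

theorem top_unique (hL : LinOrd L) (hy : Top L W y) (hz : Top L W z) : y = z := by
  rcases hL.seg_cases hy.seg_mem with ⟨a, rfl⟩ | ⟨V, x, hV, hx, rfl⟩
  · rw [mem_sSingle.1 hy.mem, mem_sSingle.1 hz.mem]
  · have key : ∀ {y}, Top L (sIns V x) y → y = x := fun h => by
      rcases mem_sIns.1 h.mem with h' | h'
      · exact absurd (h.least V hV h' x (self_mem_sIns ..)) hx
      · exact h'
    rw [key hy, key hz]

theorem exists_seg (hL : LinOrd L) (hy : y ε sUnion L) : ∃ W, Top L W y := by
  obtain ⟨V, hV, hyV⟩ := mem_sUnion.1 hy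
  have := hL.induction (P := fun V => ∀ y, y ε V → ∃ W, W ε L ∧ y ε W ∧
      ∀ V', V' ε L → y ε V' → Incl W V')
    ⟨ball (var 0) (bex (var 2) (and (mem (var 1) (var 0)) (ball (var 3)
      (imp (mem (var 2) (var 0)) (sub (var 1) (var 0)))))), fun _ => L, fun W => by simp⟩
    (fun a ha y hy => by
      obtain rfl := mem_sSingle.1 hy
      exact ⟨_, ha, by simp, (hL.top_single ha).least⟩)
    (fun W z hW ih hz hzL y hy => by
      rcases mem_sIns.1 hy with hy | rfl
      · exact ih y hy
      · exact ⟨_, hzL, self_mem_sIns .., (hL.top_ins hW hz hzL).least⟩) hV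
  obtain ⟨W, h1, h2, h3⟩ := this y hyV
  exact ⟨W, h1, h2, h3⟩

theorem top_seg_eq_union_iff (hL : LinOrd L) (h : Top L (sUnion L) y) (h' : Top L W z) :
    W = sUnion L ↔ z = y :=
  ⟨fun e => hL.top_unique (e ▸ h') h, fun e => h'.seg_unique (e ▸ h)⟩

/-- Induction along a linear ordering, with reference to the last elements of the segments. -/
theorem induction_top (hL : LinOrd L) {P : M → Prop} (hP : Definable P)
    (h1 : ∀ a, sSingle a ε L → P (sSingle a))
    (h2 : ∀ W y z, Top L W y → P W → ¬ z ε W → sIns W z ε L → P (sIns W z)) {V : M}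
    (hV : V ε L) : P V :=
  hL.induction hP h1 (fun W z hW hPW hz hzL =>
    let ⟨y, hy⟩ := hL.exists_top hW
    h2 W y z hy hPW hz hzL) hV

end LinOrd

/-! ### First, last and next elements -/

/-- The way in which `First`, `Last` and `Next` are defined: if `a` is the only member of `s`
satisfying `A`, then `⋃ {x ∈ s : A}` is `a`. -/
theorem tv_union_sep_eq (v : ℕ → M) (s : Tm) (A : Fm false)
    (h : ∀ y, y ε tv v s ∧ tr (y ∷ v) A ↔ y = a) : tv v (union (sep s A)) = a :=
  ext _ _ fun x => by simp [h]

variable {v : ℕ → M} {s t : Tm}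

theorem tv_first (hL : LinOrd (tv v t)) (ha : sSingle a ε tv v t) : tv v (first t) = a := by
  refine tv_union_sep_eq v _ _ fun y => ?_
  simp only [field, tv_union, tr_ball, tv_up, tr_mem, tv_var, push_one, push_zero]
  constructor
  · rintro ⟨-, h⟩
    exact mem_sSingle.1 (h _ ha)
  · rintro rfl
    exact ⟨(hL.top_single ha).mem_union, fun W hW => hL.single_incl ha hW _ (by simp)⟩

theorem tv_last (hL : LinOrd (tv v t)) (hy : Top (tv v t) (sUnion (tv v t)) y) :
    tv v (last t) = y := by
  refine tv_union_sep_eq v _ _ fun z => ?_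
  simp only [field, tv_union, tr_ball, tv_up, tr_imp, tr_eq, tr_mem, tv_var, push_one, push_zero]
  constructor
  · rintro ⟨hz, h⟩
    obtain ⟨W, hW⟩ := hL.exists_seg hz
    exact (hL.top_seg_eq_union_iff hy hW).1 (h W hW.seg_mem hW.mem)
  · rintro rfl
    exact ⟨hy.mem_union, fun W hW hyW =>
      Incl.antisymm (fun x hx => mem_sUnion.2 ⟨W, hW, hx⟩) (hy.least W hW hyW)⟩

theorem tv_next (hL : LinOrd (tv v t)) (hs : Top (tv v t) W (tv v s)) (hz : ¬ z ε W)
    (hzL : sIns W z ε tv v t) : tv v (next t s) = z := by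
  have hzU : z ε sUnion (tv v t) := (hL.top_ins hs.seg_mem hz hzL).mem_union
  obtain ⟨l, hl⟩ := hL.exists_top (hL.union_mem ⟨W, hs.seg_mem⟩)
  have hsl : tv v s ≠ l := fun h => by
    rw [(hL.top_seg_eq_union_iff hl hs).2 h] at hz
    exact hz hzU
  refine tv_union_sep_eq v _ _ fun y => ?_
  simp only [field, ltOrd, tv_union, tr_ball, tr_bex, tv_up, tr_imp, tr_eq, tr_mem, tr_or, tr_and,
    tr_neg, tv_var, push_one, push_zero]
  rw [tv_last (v := y ∷ v) (y := l) (by rwa [tv_up]) (by rwa [tv_up])]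
  constructor
  · rintro ⟨hy, ⟨h, -⟩ | ⟨⟨V, hV, hsV, hyV⟩, h⟩⟩
    · exact absurd h hsl
    · have hyW : ¬ y ε W := fun h => hyV (hs.least V hV hsV y h)
      by_contra hne
      refine h z hzU ⟨W, hs.seg_mem, hs.mem, hz⟩ ⟨_, hzL, self_mem_sIns .., fun h' => ?_⟩
      rcases mem_sIns.1 h' with h' | h'
      exacts [hyW h', hne h']
  · rintro rfl
    refine ⟨hzU, Or.inr ⟨⟨W, hs.seg_mem, hs.mem, hz⟩, ?_⟩⟩
    rintro x hx ⟨V, hV, hsV, hxV⟩ ⟨V', hV', hxV', hyV'⟩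
    have hxW : ¬ x ε W := fun h => hxV (hs.least V hV hsV x h)
    rcases hL.total _ _ hzL hV' with h | h
    · exact hyV' (h _ (self_mem_sIns ..))
    · rcases mem_sIns.1 (h x hxV') with h | rfl
      exacts [hxW h, hyV' hxV']

/-- Successive elements of a linear ordering, described with `Last` and `Next` on the one hand
and with initial segments on the other. -/
theorem forall_next_iff (hL : LinOrd (tv v t)) (R : M → M → Prop) :
    (∀ x, x ε sUnion (tv v t) → x ≠ tv (x ∷ v) (last t.up) →
      R x (tv (x ∷ v) (next t.up (var 0)))) ↔
    ∀ W y z, Top (tv v t) W y → ¬ z ε W → sIns W z ε tv v t → R y z := by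
  have hlast : ∀ {x l}, Top (tv v t) (sUnion (tv v t)) l → tv (x ∷ v) (last t.up) = l :=
    fun h => tv_last (by rwa [tv_up]) (by rwa [tv_up])
  have hnext : ∀ {W y z}, Top (tv v t) W y → ¬ z ε W → sIns W z ε tv v t →
      tv (y ∷ v) (next t.up (var 0)) = z := fun h hz hzL =>
    tv_next (by rwa [tv_up]) (by rwa [tv_up]) hz (by rwa [tv_up])
  constructor
  · intro h W y z hy hz hzL
    obtain ⟨l, hl⟩ := hL.exists_top (hL.union_mem ⟨W, hy.seg_mem⟩)
    have := h y hy.mem_union ?_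
    · rwa [hnext hy hz hzL] at this
    · rw [hlast hl]
      intro h
      obtain rfl := (hL.top_seg_eq_union_iff hl hy).2 h
      exact hz (hL.top_ins hy.seg_mem hz hzL).mem_union
  · intro h x hx hne
    obtain ⟨W, hW⟩ := hL.exists_seg hx
    rcases hL.step W hW.seg_mem with rfl | ⟨z, -, hz, hzL⟩
    · exact absurd (hlast hW).symm hne
    · rw [hnext hW hz hzL]
      exact h W x z hW hz hzL

/-- `L` is a linear ordering whose first element satisfies `A` and in which `R` holds between each
element and the next one. -/
structure Succession (A : M → Prop) (R : M → M → Prop) (L : M) : Prop where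
  linOrd : LinOrd L
  first : ∀ a, sSingle a ε L → A a
  next : ∀ W y z, Top L W y → ¬ z ε W → sIns W z ε L → R y z

/-- `L` is a member of the iteration system with initial term `∅` and successor function `σ`. -/
def Has (σ : M → M) (L : M) : Prop := Succession (fun a => a = sEmpty) (fun y z => z = σ y) L

/-- `L` is an `∈`-chain for `s`. -/
structure Chain (L s : M) : Prop where
  succession : Succession (fun a => a ε s) (fun y z => z ε y) L
  exists_mem : ∃ W, W ε L

theorem tr_has {b : Bool} {N : IterationSystem} (h0 : N.zero = empty) {σ : M → M}
    (hσ : ∀ v : ℕ → M, tv v N.succ = σ (v 0)) (v : ℕ → M) (t : Tm) :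
    tr v (N.has t : Fm b) ↔ Has σ (tv v t) := by
  simp only [IterationSystem.has, field, tr_and, tr_or, tr_eq, tr_neg, tr_ball, tr_imp, tr_isLinOrd,
    tv_inst, hσ, h0, tv_var, tv_empty, tv_union, push_zero]
  constructor
  · rintro ⟨hL, h⟩
    refine ⟨hL, fun a ha => ?_, ?_⟩
    · rw [← tv_first hL ha]
      rcases h with h | h
      · exact absurd ha (eq_empty_iff.1 h _)
      · exact h.2.1
    · rcases h with h | h
      · exact fun W y z hy => absurd hy.seg_mem (eq_empty_iff.1 h _)
      · exact (forall_next_iff hL fun y z => z = σ y).1 h.2.2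
  · rintro ⟨hL, h1, h2⟩
    refine ⟨hL, or_iff_not_imp_left.2 fun h => ⟨h, ?_, (forall_next_iff hL fun y z => z = σ y).2 h2⟩⟩
    obtain ⟨a, ha⟩ := hL.first (ne_empty_iff.1 h)
    rw [tv_first hL ha, h1 a ha]

theorem tr_isChain {b : Bool} (v : ℕ → M) (s t : Tm) :
    tr v (isChain t s : Fm b) ↔ Chain (tv v t) (tv v s) := by
  simp only [isChain, field, tr_and, tr_eq, tr_neg, tr_ball, tr_imp, tr_isLinOrd, tr_mem,
    tv_var, tv_empty, tv_union, push_zero]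
  constructor
  · rintro ⟨hL, h, h1, h2⟩
    refine ⟨⟨hL, fun a ha => ?_, (forall_next_iff hL fun y z => z ε y).1 h2⟩, ne_empty_iff.1 h⟩
    rwa [← tv_first hL ha]
  · rintro ⟨⟨hL, h1, h2⟩, h⟩
    refine ⟨hL, ne_empty_iff.2 h, ?_, (forall_next_iff hL fun y z => z ε y).2 h2⟩
    obtain ⟨a, ha⟩ := hL.first h
    rw [tv_first hL ha]
    exact h1 a ha

end Induction

/-! ### Extension and truncation of linear orderings -/

section Extension

variable {M : Type} [SetStructure M] [FiniteModel M] {L W V X x y z a s : M}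
  {A : M → Prop} {R : M → M → Prop}

theorem succession_empty : Succession A R (sEmpty : M) :=
  ⟨linOrd_empty, fun _ h => absurd h not_mem_sEmpty, fun _ _ _ h => absurd h.1 not_mem_sEmpty⟩

theorem mem_sUnion_of_mem (hx : x ε W) (hW : W ε L) : x ε sUnion L := mem_sUnion.2 ⟨W, hW, hx⟩

/-- The linear ordering `L` extended by the last element `s`. -/
noncomputable def sAppend (L s : M) : M := sIns L (sIns (sUnion L) s)

theorem sUnion_sAppend : sUnion (sAppend L s) = sIns (sUnion L) s := by
  refine ext _ _ fun x => ?_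
  simp only [sAppend, mem_sUnion, mem_sIns]
  constructor
  · rintro ⟨W, hW | rfl, hx⟩
    · exact Or.inl ⟨W, hW, hx⟩
    · simpa using hx
  · rintro (⟨W, hW, hx⟩ | rfl)
    · exact ⟨W, Or.inl hW, hx⟩
    · exact ⟨_, Or.inr rfl, self_mem_sIns ..⟩

theorem last_seg_not_mem (hs : ¬ s ε sUnion L) : ¬ sIns (sUnion L) s ε L := fun h =>
  hs (mem_sUnion_of_mem (self_mem_sIns ..) h)

theorem LinOrd.append (hL : LinOrd L) (hs : ¬ s ε sUnion L) : LinOrd (sAppend L s) where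
  nonempty W hW := by
    rcases mem_sIns.1 hW with hW | rfl
    exacts [hL.nonempty W hW, ⟨s, self_mem_sIns ..⟩]
  first _ := by
    by_cases h : ∃ W, W ε L
    · obtain ⟨a, ha⟩ := hL.first h
      exact ⟨a, mem_sIns.2 (Or.inl ha)⟩
    · refine ⟨s, mem_sIns.2 (Or.inr (ext _ _ fun x => ?_))⟩
      simp only [mem_sSingle, mem_sIns, mem_sUnion, iff_or_self]
      exact fun ⟨W, hW, _⟩ => absurd ⟨W, hW⟩ h
  step W hW := by
    rw [sUnion_sAppend]
    rcases mem_sIns.1 hW with hW | rfl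
    · right
      rcases hL.step W hW with rfl | ⟨y, hy, hyW, hyL⟩
      · exact ⟨s, self_mem_sIns .., hs, mem_sIns.2 (Or.inr rfl)⟩
      · exact ⟨y, incl_sIns _ _ _ hy, hyW, mem_sIns.2 (Or.inl hyL)⟩
    · exact Or.inl rfl
  total V W hV hW := by
    have key : ∀ {V}, V ε L → Incl V (sIns (sUnion L) s) := fun hV x hx =>
      incl_sIns _ _ _ (mem_sUnion_of_mem hx hV)
    rcases mem_sIns.1 hV with hV | rfl <;> rcases mem_sIns.1 hW with hW | rfl
    exacts [hL.total V W hV hW, Or.inl (key hV), Or.inr (key hW), Or.inl (Incl.refl _)]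

theorem top_append (hs : ¬ s ε sUnion L) :
    Top (sAppend L s) (sUnion (sAppend L s)) s := by
  rw [sUnion_sAppend]
  refine ⟨mem_sIns.2 (Or.inr rfl), self_mem_sIns .., fun V hV hsV => ?_⟩
  rcases mem_sIns.1 hV with hV | rfl
  exacts [absurd (mem_sUnion_of_mem hsV hV) hs, Incl.refl _]

theorem Succession.append (h : Succession A R L) (hs : ¬ s ε sUnion L)
    (h0 : (∀ W, ¬ W ε L) → A s) (h1 : ∀ l, Top L (sUnion L) l → R l s) :
    Succession A R (sAppend L s) where
  linOrd := h.linOrd.append hs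
  first a ha := by
    rcases mem_sIns.1 ha with ha | ha
    · exact h.first a ha
    · have hsa : s = a := mem_sSingle.1 (ha ▸ self_mem_sIns ..)
      subst hsa
      refine h0 fun W hW => ?_
      obtain ⟨x, hx⟩ := h.linOrd.nonempty W hW
      have hxU := mem_sUnion_of_mem hx hW
      exact hs (mem_sSingle.1 (ha ▸ incl_sIns _ _ _ hxU) ▸ hxU)
  next W y z hy hz hzL := by
    have hWL : W ε L := by
      rcases mem_sIns.1 hy.seg_mem with hW | rfl
      · exact hW
      · rcases mem_sIns.1 hzL with hzL | hzL
        · exact absurd (mem_sUnion_of_mem (incl_sIns _ _ _ (self_mem_sIns ..)) hzL) hs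
        · exact absurd (hzL ▸ self_mem_sIns ..) hz
    have hyL : Top L W y := ⟨hWL, hy.mem, fun V hV => hy.least V (mem_sIns.2 (Or.inl hV))⟩
    rcases mem_sIns.1 hzL with hzL | hzL
    · exact h.next W y z hyL hz hzL
    · have hsz : s = z := by
        rcases mem_sIns.1 (hzL.symm ▸ self_mem_sIns (sUnion L) s : s ε sIns W z) with h | h
        exacts [absurd (mem_sUnion_of_mem h hWL) hs, h]
      subst hsz
      have hWU : W = sUnion L := by
        refine ext _ _ fun x => ⟨fun hx => mem_sUnion_of_mem hx hWL, fun hx => ?_⟩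
        rcases mem_sIns.1 (hzL.symm ▸ incl_sIns _ _ _ hx : x ε sIns W s) with h | rfl
        exacts [h, absurd hx hs]
      exact h1 y (hWU ▸ hyL)

/-- The initial segment `W` of a linear ordering is the field of a linear ordering. -/
theorem Succession.truncate (h : Succession A R L) (hW : W ε L) :
    ∃ K, Succession A R K ∧ sUnion K = W ∧ W ε K ∧ ∀ V y, Top K V y → Top L V y := by
  have hL := h.linOrd
  obtain ⟨K, hK⟩ := Definable.exists_sep (a := L) (P := fun V => Incl V W)
    ⟨sub (var 0) (var 1), fun _ => W, fun V => by simp⟩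
  have hWK : W ε K := (hK W).2 ⟨hW, Incl.refl W⟩
  have hU : sUnion K = W := ext _ _ fun x => by
    rw [mem_sUnion]
    exact ⟨fun ⟨V, hV, hx⟩ => ((hK V).1 hV).2 x hx, fun hx => ⟨W, hWK, hx⟩⟩
  have hTop : ∀ V y, Top K V y → Top L V y := fun V y hV => by
    refine ⟨((hK V).1 hV.seg_mem).1, hV.mem, fun V' hV' hy => ?_⟩
    rcases hL.total _ _ hV' hW with h | h
    · exact hV.least V' ((hK V').2 ⟨hV', h⟩) hy
    · exact ((hK V).1 hV.seg_mem).2.trans h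
  refine ⟨K, ⟨⟨fun V hV => hL.nonempty V ((hK V).1 hV).1, fun _ => ?_, fun V hV => ?_,
    fun V V' hV hV' => hL.total V V' ((hK V).1 hV).1 ((hK V').1 hV').1⟩,
    fun a ha => h.first a ((hK _).1 ha).1, fun V y z hy hz hzK =>
      h.next V y z (hTop V y hy) hz ((hK _).1 hzK).1⟩, hU, hWK, hTop⟩
  · obtain ⟨a, ha⟩ := hL.first ⟨W, hW⟩
    exact ⟨a, (hK _).2 ⟨ha, hL.single_incl ha hW⟩⟩
  · obtain ⟨hVL, hVW⟩ := (hK V).1 hV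
    rw [hU]
    refine or_iff_not_imp_left.2 fun hne => ?_
    rcases hL.step V hVL with h | ⟨y, -, hy, hyL⟩
    · exact absurd (hVW.antisymm (h ▸ fun x hx => mem_sUnion_of_mem hx hW)) hne
    · by_cases hyW : y ε W
      · exact ⟨y, hyW, hy, (hK _).2 ⟨hyL, hL.ins_incl hy hVL hW hyW⟩⟩
      · refine absurd (hVW.antisymm fun x hx => ?_) hne
        rcases hL.total _ _ hW hyL with h | h
        · rcases mem_sIns.1 (h x hx) with h | rfl
          exacts [h, absurd hx hyW]
        · exact absurd (h y (self_mem_sIns ..)) hyW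

end Extension

/-! ### The transitive closure -/

section TransitiveClosure

variable {M : Type} [SetStructure M] [FiniteModel M] {L W V X T x y z a s : M}

/-- `x` belongs to the transitive closure of `s`. -/
def InTC (x s : M) : Prop := ∃ C, Chain C s ∧ x ε sUnion C

theorem mem_tv_tc (hfan : ∀ a s : M, a ε SetStructure.fan s ↔ Chain a s) (v : ℕ → M) (t : Tm) :
    x ε tv v (tc t) ↔ InTC x (tv v t) := by
  simp only [tc, field, tv_union, mem_sUnion (a := tv _ _), mem_tv_repl, tv_fan, hfan, tv_var,
    push_zero, InTC]
  constructor
  · rintro ⟨_, ⟨C, hC, rfl⟩, hx⟩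
    exact ⟨C, hC, hx⟩
  · rintro ⟨C, hC, hx⟩
    exact ⟨_, ⟨C, hC, rfl⟩, hx⟩

theorem InTC.of_mem (h : x ε s) : InTC x s := by
  refine ⟨sAppend sEmpty x, ⟨succession_empty.append ?_ (fun _ => h) fun l hl => ?_, ?_⟩, ?_⟩
  · simp
  · exact absurd hl.seg_mem not_mem_sEmpty
  · exact ⟨_, self_mem_sIns ..⟩
  · rw [sUnion_sAppend]; exact self_mem_sIns ..

theorem InTC.of_mem_of_inTC (h : y ε x) (hx : InTC x s) : InTC y s := by
  obtain ⟨C, hC, hxC⟩ := hx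
  have hL := hC.succession.linOrd
  obtain ⟨W, hW⟩ := hL.exists_seg hxC
  by_cases hyW : y ε W
  · exact ⟨C, hC, mem_sUnion_of_mem hyW hW.seg_mem⟩
  obtain ⟨K, hK, hU, hWK, hTop⟩ := hC.succession.truncate hW.seg_mem
  refine ⟨sAppend K y, ⟨hK.append (hU.symm ▸ hyW) (fun h => absurd hWK (h W)) fun l hl => ?_,
    ⟨_, self_mem_sIns ..⟩⟩, by rw [sUnion_sAppend]; exact self_mem_sIns ..⟩
  rw [hU] at hl
  rwa [hL.top_unique (hTop _ _ hl) hW]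

/-- The set `T` is transitive. -/
def IsTrans (T : M) : Prop := ∀ x, x ε T → Incl x T

theorem Chain.field_incl {C : M} (hC : Chain C s) (hs : Incl s T) (hT : IsTrans T) :
    ∀ W, W ε C → Incl W T := fun W hW => by
  refine hC.succession.linOrd.induction_top (P := fun W => Incl W T)
    ⟨sub (var 0) (var 1), fun _ => T, fun V => by simp⟩ (fun a ha x hx => ?_)
    (fun W y z hy ih hz hzL x hx => ?_) hW
  · rw [mem_sSingle.1 hx]
    exact hs a (hC.succession.first a ha)
  · rcases mem_sIns.1 hx with hx | rfl
    · exact ih x hx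
    · exact hT y (ih y hy.mem) _ (hC.succession.next W y _ hy hz hzL)

/-- A model of `EA₁`. -/
class Model (M : Type) [SetStructure M] : Prop extends FiniteModel M where
  mem_fan : ∀ a s : M, a ε SetStructure.fan s ↔ Chain a s
  foundation : ∀ a b : M, InTC a b → ¬ InTC b a

theorem InTC.trans {M : Type} [SetStructure M] [Model M] {x y z : M} (h : InTC x y) (h' : InTC y z) : InTC x z := by
  have hmem : ∀ x, x ε tv (z ∷ fun _ => z) (tc (var 0)) ↔ InTC x z :=
    fun x => mem_tv_tc Model.mem_fan _ _
  obtain ⟨C, hC, hx⟩ := h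
  obtain ⟨W, hW, hx⟩ := mem_sUnion.1 hx
  refine (hmem x).1 (hC.field_incl (fun u hu => ?_) (fun u hu w hw => ?_) W hW x hx)
  · exact (hmem u).2 (InTC.of_mem_of_inTC hu h')
  · exact (hmem w).2 (InTC.of_mem_of_inTC hw ((hmem u).1 hu))

theorem not_mem_self {M : Type} [SetStructure M] [Model M] (x : M) : ¬ x ε x := fun h =>
  Model.foundation x x (InTC.of_mem h) (InTC.of_mem h)

end TransitiveClosure

/-! ### Members of the natural number systems -/

section NatSystem

variable {M : Type} [SetStructure M] [Model M] {L S W V X T x y z a s l : M} {σ : M → M}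

theorem Has.linOrd (h : Has σ L) : LinOrd L := Succession.linOrd h

/-- The successor of the last element of `L` does not lie in `L`. -/
theorem Has.not_mem_field (h : Has σ L) (hσ : ∀ x, x ε σ x) (hl : Top L (sUnion L) l) :
    ¬ σ l ε sUnion L := fun ha => by
  -- `Z` consists of the elements of `L` from `σ l` on
  obtain ⟨Z, hZ⟩ := Definable.exists_sep (a := sUnion L) (P := fun y => y = σ l ∨ InTC (σ l) y)
    ⟨or (eq (var 0) (var 1)) (mem (var 1) (tc (var 0))), fun _ => σ l, fun y => by
      simp [mem_tv_tc Model.mem_fan]⟩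
  have key := h.linOrd.induction_top (P := fun W => σ l ε W → ∃ y, y ε Z ∧ y ε W ∧
      ∀ V, V ε L → y ε V → Incl W V)
    ⟨imp (mem (var 3) (var 0)) (bex (var 2) (and (mem (var 0) (var 1)) (ball (var 2)
      (imp (mem (var 1) (var 0)) (sub (var 2) (var 0)))))), L ∷ Z ∷ fun _ => σ l,
      fun W => by simp⟩
    (fun a ha h' => by
      have htop := h.linOrd.top_single ha
      exact ⟨a, (hZ _).2 ⟨htop.mem_union, Or.inl (mem_sSingle.1 h').symm⟩, htop.mem, htop.least⟩)
    (fun W y z hy ih hz hzL h' => by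
      have htop := h.linOrd.top_ins hy.seg_mem hz hzL
      refine ⟨z, (hZ _).2 ⟨htop.mem_union, ?_⟩, self_mem_sIns .., htop.least⟩
      rcases mem_sIns.1 h' with h' | h'
      · obtain ⟨y', hy'Z, hy'W, hy'⟩ := ih h'
        obtain rfl := h.linOrd.top_unique hy ⟨hy.seg_mem, hy'W, hy'⟩
        have hyz : y ε z := by
          rw [show z = σ y from Succession.next h W y z hy hz hzL]
          exact hσ y
        rcases ((hZ y).1 hy'Z).2 with rfl | h2
        · exact Or.inr (InTC.of_mem hyz)
        · exact Or.inr (h2.trans (InTC.of_mem hyz))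
      · exact Or.inl h'.symm)
    hl.seg_mem ha
  obtain ⟨y, hyZ, hy1, hy2⟩ := key
  obtain rfl := h.linOrd.top_unique hl ⟨hl.seg_mem, hy1, hy2⟩
  rcases ((hZ _).1 hyZ).2 with h1 | h1
  · have hl' := hσ l
    rw [← h1] at hl'
    exact not_mem_self l hl'
  · exact Model.foundation _ _ h1 (InTC.of_mem (hσ l))

open Classical in
/-- The element generated after those of `L`: the successor of the last element, or `∅` if `L`
is empty. -/
noncomputable def nextOf (σ : M → M) (L : M) : M :=
  if h : ∃ l, Top L (sUnion L) l then σ h.choose else sEmpty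

theorem nextOf_eq (hL : LinOrd L) (hl : Top L (sUnion L) l) : nextOf σ L = σ l := by
  have h : ∃ l, Top L (sUnion L) l := ⟨l, hl⟩
  rw [nextOf, dif_pos h, hL.top_unique h.choose_spec hl]

theorem nextOf_eq_empty (h : ∀ W, ¬ W ε L) : nextOf σ L = sEmpty :=
  dif_neg fun ⟨_, hl⟩ => h _ hl.seg_mem

/-- The successor operation on the members of the system. -/
noncomputable def sSucc (σ : M → M) (L : M) : M := sAppend L (nextOf σ L)

theorem Has.nextOf_not_mem (h : Has σ L) (hσ : ∀ x, x ε σ x) : ¬ nextOf σ L ε sUnion L := by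
  intro hn
  obtain ⟨W, hW, -⟩ := mem_sUnion.1 hn
  obtain ⟨l, hl⟩ := h.linOrd.exists_top (h.linOrd.union_mem ⟨W, hW⟩)
  rw [nextOf_eq h.linOrd hl] at hn
  exact h.not_mem_field hσ hl hn

theorem Has.succ (h : Has σ L) (hσ : ∀ x, x ε σ x) : Has σ (sSucc σ L) :=
  Succession.append h (h.nextOf_not_mem hσ) (fun h' => nextOf_eq_empty h')
    fun _ hl => nextOf_eq h.linOrd hl

theorem Has.succ_iterate (h : Has σ L) (hσ : ∀ x, x ε σ x) (n : ℕ) : Has σ ((sSucc σ)^[n] L) := by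
  induction n with
  | zero => exact h
  | succ n ih => rw [Function.iterate_succ_apply']; exact ih.succ hσ

theorem Has.nextOf_succ (h : Has σ L) (hσ : ∀ x, x ε σ x) :
    nextOf σ (sSucc σ L) = σ (nextOf σ L) :=
  nextOf_eq (h.succ hσ).linOrd (top_append (h.nextOf_not_mem hσ))

/-- Of two members of a system, the first is an initial part of the second, unless it contains
the element to be generated after the second. -/
theorem Has.incl_of_not_mem (hL : Has σ L) (hS : Has σ S) (hn : ¬ nextOf σ S ε sUnion L) :
    Incl L S := fun W hW => by
  refine (hL.linOrd.induction_top (P := fun W => W ε S ∧ ∀ y, y ε W →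
      (∀ V, V ε L → y ε V → Incl W V) → ∀ V, V ε S → y ε V → Incl W V)
    ⟨and (mem (var 0) (var 2)) (ball (var 0) (imp
      (ball (var 2) (imp (mem (var 1) (var 0)) (sub (var 2) (var 0))))
      (ball (var 3) (imp (mem (var 1) (var 0)) (sub (var 2) (var 0)))))), L ∷ fun _ => S,
      fun W => by simp⟩ (fun a ha => ?_) (fun W y z hy ih hz hzL => ?_) hW).1
  · have haS : sSingle a ε S := by
      by_cases h : ∃ W, W ε S
      · obtain ⟨b, hb⟩ := hS.linOrd.first h
        rwa [Succession.first hL a ha, ← Succession.first hS b hb]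
      · rw [nextOf_eq_empty fun W hW => h ⟨W, hW⟩, ← Succession.first hL a ha] at hn
        exact absurd (hL.linOrd.top_single ha).mem_union hn
    refine ⟨haS, fun y hy _ => ?_⟩
    obtain rfl := mem_sSingle.1 hy
    exact (hS.linOrd.top_single haS).least
  · obtain ⟨hWS, hmin⟩ := ih
    have hyS : Top S W y := ⟨hWS, hy.mem, hmin y hy.mem hy.least⟩
    have htop := hL.linOrd.top_ins hy.seg_mem hz hzL
    have hzy : z = σ y := Succession.next hL W y z hy hz hzL
    have hzS : sIns W z ε S := by
      rcases hS.linOrd.step W hWS with rfl | ⟨z', -, hz', hzS'⟩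
      · rw [nextOf_eq hS.linOrd hyS, ← hzy] at hn
        exact absurd htop.mem_union hn
      · rwa [hzy, ← Succession.next hS W y z' hyS hz' hzS']
    refine ⟨hzS, fun u hu hu' => ?_⟩
    obtain rfl := hL.linOrd.top_unique htop ⟨hzL, hu, hu'⟩
    exact (hS.linOrd.top_ins hWS hz hzS).least

end NatSystem

/-! ### Growth of terms -/

section Growth

variable {M : Type} [SetStructure M] [Model M] {L S W V X T x y z a s l : M} {σ : M → M}

theorem IsTrans.pow (hT : IsTrans T) : IsTrans (sPow T) := fun _ hx y hy =>
  mem_sPow.2 (hT y (mem_sPow.1 hx y hy))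

theorem IsTrans.iterate_sPow (hT : IsTrans T) (n : ℕ) : IsTrans (sPow^[n] T) := by
  induction n with
  | zero => exact hT
  | succ n ih => rw [Function.iterate_succ_apply']; exact ih.pow

theorem IsTrans.incl_sPow (hT : IsTrans T) : Incl T (sPow T) := fun x hx =>
  mem_sPow.2 (hT x hx)

theorem IsTrans.iterate_sPow_mono (hT : IsTrans T) {m n : ℕ} (h : m ≤ n) :
    Incl (sPow^[m] T) (sPow^[n] T) := by
  induction n, h using Nat.le_induction with
  | base => exact Incl.refl _
  | succ n _ ih =>
    rw [Function.iterate_succ_apply']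
    exact ih.trans (hT.iterate_sPow n).incl_sPow

/-- The expression, if it is a term, raises ranks by at most `k`: over a transitive set `T` its
values are included in the `k`-fold power set of `T`. -/
def RankBound (k : ℕ) : {κ : Kind} → Expr κ → Prop
  | Kind.term, t => ∀ (M : Type) [SetStructure M] [Model M] (n : ℕ) (v : ℕ → M) (T : M),
      t.FreeBelow n → IsTrans T → (∀ i < n, Incl (v i) T) → Incl (tv v t) (sPow^[k] T)
  | Kind.formula _, _ => True

/-- Each term raises ranks by a fixed finite amount. Comprehension only removes members, so
formulas play no role. -/
theorem exists_rankBound {κ : Kind} (e : Expr κ) : ∃ k, RankBound k e := by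
  induction e with
  | mem | eq | sub | neg | and | or | imp | all | ex => exact ⟨0, trivial⟩
  | var i => exact ⟨0, fun M _ _ n v T hn hT hv => hv i hn⟩
  | empty => exact ⟨0, fun M _ _ n v T hn hT hv x hx => absurd hx not_mem_sEmpty⟩
  | pair s t ihs iht =>
    obtain ⟨k, hk⟩ := ihs
    obtain ⟨l, hl⟩ := iht
    refine ⟨max k l + 1, fun M _ _ n v T hn hT hv x hx => ?_⟩
    rw [Function.iterate_succ_apply', mem_sPow]
    rcases mem_sPair.1 hx with rfl | rfl
    · exact (hk M n v T hn.1 hT hv).trans (hT.iterate_sPow_mono (le_max_left k l))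
    · exact (hl M n v T hn.2 hT hv).trans (hT.iterate_sPow_mono (le_max_right k l))
  | pow s ih =>
    obtain ⟨k, hk⟩ := ih
    refine ⟨k + 1, fun M _ _ n v T hn hT hv x hx => ?_⟩
    rw [Function.iterate_succ_apply', mem_sPow]
    exact (mem_sPow.1 hx).trans (hk M n v T hn hT hv)
  | union s ih =>
    obtain ⟨k, hk⟩ := ih
    refine ⟨k, fun M _ _ n v T hn hT hv x hx => ?_⟩
    obtain ⟨y, hy, hx⟩ := mem_sUnion.1 hx
    exact hT.iterate_sPow k y (hk M n v T hn hT hv y hy) x hx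
  | fan s ih =>
    obtain ⟨k, hk⟩ := ih
    refine ⟨k + 2, fun M _ _ n v T hn hT hv C hC => ?_⟩
    rw [Function.iterate_succ_apply', Function.iterate_succ_apply', mem_sPow]
    intro W hW
    rw [mem_sPow]
    exact ((Model.mem_fan C _).1 hC).field_incl (hk M n v T hn hT hv) (hT.iterate_sPow k) W hW
  | sep s A ih =>
    obtain ⟨k, hk⟩ := ih
    refine ⟨k, fun M _ _ n v T hn hT hv x hx => hk M n v T hn.1 hT hv x ?_⟩
    exact ((mem_tv_sep ..).1 hx).1
  | repl t s iht ihs =>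
    obtain ⟨l, hl⟩ := iht
    obtain ⟨k, hk⟩ := ihs
    refine ⟨l + k + 1, fun M _ _ n v T hn hT hv x hx => ?_⟩
    rw [Function.iterate_succ_apply', mem_sPow, Function.iterate_add_apply]
    obtain ⟨y, hy, rfl⟩ := (mem_tv_repl ..).1 hx
    refine hl M (n + 1) (y ∷ v) _ hn.1 (hT.iterate_sPow k) fun i hi => ?_
    cases i with
    | zero => exact hT.iterate_sPow k y (hk M n v T hn.2 hT hv y hy)
    | succ i =>
      exact (hv i (by omega)).trans (hT.iterate_sPow_mono (Nat.zero_le k))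

/-- In the models of `EA₁`, the iteration system is generated from `∅` by a function with
`x ∈ σ(x)`, and the field of each of its members is included in a transitive set which does not
contain the element to be generated next. -/
structure RankedSystem (N : IterationSystem) : Prop where
  zero_eq : N.zero = empty
  exists_fun : ∀ (M : Type) [SetStructure M] [Model M], ∃ σ : M → M,
    (∀ v : ℕ → M, tv v N.succ = σ (v 0)) ∧ (∀ x, x ε σ x) ∧
    ∀ L, Has σ L → ∃ T, IsTrans T ∧ Incl (sUnion L) T ∧ ¬ nextOf σ L ε T

theorem Has.nextOf_not_mem_iterate (h : Has σ L) (hσ : ∀ x, x ε σ x) (hT : ¬ nextOf σ L ε T)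
    (n : ℕ) : ¬ nextOf σ ((sSucc σ)^[n] L) ε sPow^[n] T := by
  induction n with
  | zero => exact hT
  | succ n ih =>
    rw [Function.iterate_succ_apply', (h.succ_iterate hσ n).nextOf_succ hσ,
      Function.iterate_succ_apply', mem_sPow]
    exact fun h' => ih (h' _ (hσ _))

/-- The value of a term at arguments equal to a member `L` of the system exceeds `L` by at most a
fixed number of successor steps, if it belongs to the system. -/
theorem exists_bound (η : Tm) (n : ℕ) (hη : η.FreeBelow n) :
    ∃ m, ∀ (M : Type) [SetStructure M] [Model M] (σ : M → M) (v : ℕ → M) (L : M),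
      (∀ x, x ε σ x) → Has σ L →
      (∃ T, IsTrans T ∧ Incl (sUnion L) T ∧ ¬ nextOf σ L ε T) →
      (∀ i < n, v i = L) → Has σ (tv v η) →
      Incl (tv v η) ((sSucc σ)^[m] L) ∧ tv v η ≠ (sSucc σ)^[m] L := by
  obtain ⟨k, hk⟩ := exists_rankBound η
  refine ⟨k + 2, fun M _ _ σ v L hσ hL ⟨T, hT, hLT, hn⟩ hv h => ?_⟩
  have hS := hL.succ_iterate hσ (k + 1)
  have hηT : Incl (tv v η) (sPow^[k + 1] T) := hk M n v (sPow T) hη hT.pow fun i hi W hW => by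
    rw [hv i hi] at hW
    exact mem_sPow.2 fun x hx => hLT x (mem_sUnion_of_mem hx hW)
  have hincl : Incl (tv v η) ((sSucc σ)^[k + 1] L) := by
    refine h.incl_of_not_mem hS fun h' => hL.nextOf_not_mem_iterate hσ hn (k + 1) ?_
    obtain ⟨W, hW, h'⟩ := mem_sUnion.1 h'
    exact hT.iterate_sPow (k + 1) W (hηT W hW) _ h'
  rw [Function.iterate_succ_apply']
  refine ⟨hincl.trans (incl_sIns _ _), fun he => ?_⟩
  rw [he] at hincl
  exact last_seg_not_mem (hS.nextOf_not_mem hσ) (hincl _ (self_mem_sIns ..))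

end Growth

/-! ### Adding one -/

section AddOne

variable {M : Type} [SetStructure M] [BaseModel M] {a b L T x : M}

/-- The value of the numeral `1`. -/
noncomputable def sOne : M := sCup sEmpty (sSingle sEmpty)

@[simp] theorem mem_sOne : x ε (sOne : M) ↔ x = sEmpty := by simp [sOne]

theorem sEmpty_ne_sOne : (sEmpty : M) ≠ sOne := fun h => by
  have h' : (sEmpty : M) ε sOne := mem_sOne.2 rfl
  rw [← h] at h'
  exact not_mem_sEmpty h'

/-- `a +_c b`. -/
noncomputable def sAdd (a b : M) : M :=
  sCup (sProd a (sSingle sEmpty)) (sProd b (sSingle sOne))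

theorem mem_sAdd : x ε sAdd a b ↔
    (∃ p, p ε a ∧ x = sOpair p sEmpty) ∨ ∃ q, q ε b ∧ x = sOpair q sOne := by
  simp [sAdd]

theorem tv_addition (v : ℕ → M) : tv v addition = sAdd (v 0) (v 1) := by
  rw [addition, cadd, tv_cup, tv_prod, tv_prod]; rfl

/-- `a +_c 1`. -/
noncomputable def sAddOne (a : M) : M := sAdd a sOne

theorem mem_sAddOne : x ε sAddOne a ↔
    (∃ p, p ε a ∧ x = sOpair p sEmpty) ∨ x = sOpair sEmpty sOne := by
  simp [sAddOne, mem_sAdd]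

theorem tv_addOne (v : ℕ → M) : tv v addOne = sAddOne (v 0) := by
  rw [addOne, cadd, tv_cup, tv_prod, tv_prod]; rfl

theorem tv_iter_addOne (v : ℕ → M) (n : ℕ) : tv v (iter addOne n) = sAddOne^[n] (v 0) := by
  induction n with
  | zero => rfl
  | succ n ih => rw [iter, tv_inst, tv_addOne, push_zero, ih, Function.iterate_succ_apply']

theorem IsInjection.exists_addOne {f : M} (hf : IsInjection f a b) :
    ∃ g, IsInjection g (sAddOne a) (sAddOne b) ∧
      ((∀ y, y ε b → ∃ x, x ε a ∧ sOpair x y ε f) →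
        ∀ y, y ε sAddOne b → ∃ x, x ε sAddOne a ∧ sOpair x y ε g) := by
  obtain ⟨g, hg⟩ := exists_rel (sAddOne a) (sAddOne b)
    (or (bex (var 6) (bex (var 8) (and (mem (opair (var 1) (var 0)) (var 7))
        (and (eq (var 3) (opair (var 1) empty)) (eq (var 2) (opair (var 0) empty))))))
      (and (eq (var 1) (opair empty (numeral 1))) (eq (var 0) (opair empty (numeral 1)))))
    (f ∷ a ∷ b ∷ fun _ => a)
  have hg' : ∀ p q, sOpair p q ε g ↔ p ε sAddOne a ∧ q ε sAddOne b ∧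
      ((∃ x, x ε a ∧ ∃ y, y ε b ∧ sOpair x y ε f ∧ p = sOpair x sEmpty ∧ q = sOpair y sEmpty) ∨
        p = sOpair sEmpty sOne ∧ q = sOpair sEmpty sOne) := fun p q => by
    rw [hg]
    simp only [tr_or, tr_bex, tr_and, tr_mem, tr_eq]; rfl
  have hne : ∀ x : M, sOpair x sEmpty ≠ sOpair sEmpty sOne := fun x h =>
    sEmpty_ne_sOne (sOpair_inj.1 h).2
  clear hg
  refine ⟨g, ⟨fun p hp => ?_, fun p q q' hp hq hq' h1 h2 => ?_, fun p p' q hp hp' hq h1 h2 => ?_⟩,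
    fun hs q hq => ?_⟩
  · rcases mem_sAddOne.1 hp with ⟨x, hx, rfl⟩ | rfl
    · obtain ⟨y, hy, h⟩ := hf.total x hx
      have hyb : sOpair y sEmpty ε sAddOne b := mem_sAddOne.2 (Or.inl ⟨y, hy, rfl⟩)
      exact ⟨_, hyb, (hg' ..).2 ⟨hp, hyb, Or.inl ⟨x, hx, y, hy, h, rfl, rfl⟩⟩⟩
    · have hb : sOpair sEmpty sOne ε sAddOne b := mem_sAddOne.2 (Or.inr rfl)
      exact ⟨_, hb, (hg' ..).2 ⟨hp, hb, Or.inr ⟨rfl, rfl⟩⟩⟩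
  · rcases ((hg' ..).1 h1).2.2 with ⟨x, hx, y, hy, h, rfl, rfl⟩ | ⟨rfl, rfl⟩ <;>
    rcases ((hg' ..).1 h2).2.2 with ⟨x', hx', y', hy', h', he, rfl⟩ | ⟨he, rfl⟩
    · obtain rfl := (sOpair_inj.1 he).1
      rw [hf.functional x y y' hx hy hy' h h']
    · exact absurd he (hne _)
    · exact absurd he.symm (hne _)
    · rfl
  · rcases ((hg' ..).1 h1).2.2 with ⟨x, hx, y, hy, h, rfl, rfl⟩ | ⟨rfl, rfl⟩ <;>
    rcases ((hg' ..).1 h2).2.2 with ⟨x', hx', y', hy', h', rfl, he⟩ | ⟨rfl, he⟩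
    · obtain rfl := (sOpair_inj.1 he).1
      rw [hf.injective x x' y hx hx' hy h h']
    · exact absurd he (hne _)
    · exact absurd he.symm (hne _)
    · rfl
  · rcases mem_sAddOne.1 hq with ⟨y, hy, rfl⟩ | rfl
    · obtain ⟨x, hx, h⟩ := hs y hy
      have hxa : sOpair x sEmpty ε sAddOne a := mem_sAddOne.2 (Or.inl ⟨x, hx, rfl⟩)
      exact ⟨_, hxa, (hg' ..).2 ⟨hxa, hq, Or.inl ⟨x, hx, y, hy, h, rfl, rfl⟩⟩⟩
    · have ha : sOpair sEmpty sOne ε sAddOne a := mem_sAddOne.2 (Or.inr rfl)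
      exact ⟨_, ha, (hg' ..).2 ⟨ha, hq, Or.inr ⟨rfl, rfl⟩⟩⟩

theorem Cle.addOne (h : Cle a b) : Cle (sAddOne a) (sAddOne b) := by
  obtain ⟨f, hf⟩ := h
  obtain ⟨g, hg, -⟩ := hf.exists_addOne
  exact ⟨g, hg⟩

theorem Ceq.addOne (h : Ceq a b) : Ceq (sAddOne a) (sAddOne b) := by
  obtain ⟨f, hf, hs⟩ := h
  obtain ⟨g, hg, hgs⟩ := hf.exists_addOne
  exact ⟨g, hg, hgs hs⟩

theorem ceq_ins_addOne (hT : ¬ T ε L) : Ceq (sIns L T) (sAddOne L) := by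
  obtain ⟨g, hg⟩ := exists_rel (sIns L T) (sAddOne L)
    (or (and (mem (var 1) (var 5)) (eq (var 0) (opair (var 1) empty)))
      (and (eq (var 1) (var 6)) (eq (var 0) (opair empty (numeral 1)))))
    (L ∷ T ∷ fun _ => L)
  have hg' : ∀ p q, sOpair p q ε g ↔ p ε sIns L T ∧ q ε sAddOne L ∧
      ((p ε L ∧ q = sOpair p sEmpty) ∨ (p = T ∧ q = sOpair sEmpty sOne)) := fun p q => by
    rw [hg]
    simp only [tr_or, tr_and, tr_mem, tr_eq]; rfl
  have hne : ∀ x : M, sOpair x sEmpty ≠ sOpair sEmpty sOne := fun x h =>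
    sEmpty_ne_sOne (sOpair_inj.1 h).2
  clear hg
  have hLT : ∀ {p}, p ε L → sOpair p sEmpty ε sAddOne L := fun hp =>
    mem_sAddOne.2 (Or.inl ⟨_, hp, rfl⟩)
  have hT1 : sOpair sEmpty sOne ε sAddOne L := mem_sAddOne.2 (Or.inr rfl)
  refine ⟨g, ⟨fun p hp => ?_, fun p q q' _ _ _ h1 h2 => ?_, fun p p' q _ _ _ h1 h2 => ?_⟩,
    fun q hq => ?_⟩
  · rcases mem_sIns.1 hp with h | rfl
    · exact ⟨_, hLT h, (hg' ..).2 ⟨hp, hLT h, Or.inl ⟨h, rfl⟩⟩⟩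
    · exact ⟨_, hT1, (hg' ..).2 ⟨hp, hT1, Or.inr ⟨rfl, rfl⟩⟩⟩
  · rcases ((hg' ..).1 h1).2.2 with ⟨h, rfl⟩ | ⟨rfl, rfl⟩ <;>
    rcases ((hg' ..).1 h2).2.2 with ⟨h', rfl⟩ | ⟨h', rfl⟩
    exacts [rfl, absurd (h' ▸ h) hT, absurd h' hT, rfl]
  · rcases ((hg' ..).1 h1).2.2 with ⟨h, rfl⟩ | ⟨rfl, rfl⟩ <;>
    rcases ((hg' ..).1 h2).2.2 with ⟨h', he⟩ | ⟨h', he⟩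
    exacts [(sOpair_inj.1 he).1, absurd he (hne _), absurd he.symm (hne _), h'.symm]
  · rcases mem_sAddOne.1 hq with ⟨x, hx, rfl⟩ | rfl
    · exact ⟨x, incl_sIns _ _ _ hx, (hg' ..).2 ⟨incl_sIns _ _ _ hx, hq, Or.inl ⟨hx, rfl⟩⟩⟩
    · exact ⟨T, self_mem_sIns .., (hg' ..).2 ⟨self_mem_sIns .., hq, Or.inr ⟨rfl, rfl⟩⟩⟩

theorem Ceq.refl (a : M) : Ceq a a := by
  obtain ⟨f, hf⟩ := exists_rel a a (eq (var 0) (var 1)) (fun _ => a)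
  simp only [tr_eq, tv_var, push_zero, push_one] at hf
  refine ⟨f, ⟨fun x hx => ⟨x, hx, (hf x x).2 ⟨hx, hx, rfl⟩⟩, fun x y y' _ _ _ h1 h2 => ?_,
    fun x x' y _ _ _ h1 h2 => ?_⟩, fun x hx => ⟨x, hx, (hf x x).2 ⟨hx, hx, rfl⟩⟩⟩
  · rw [((hf _ _).1 h1).2.2, ((hf _ _).1 h2).2.2]
  · rw [← ((hf _ _).1 h1).2.2, ← ((hf _ _).1 h2).2.2]

end AddOne

/-! ### The successor operation as a global function -/

/-- The term for the element to be generated after those of the variable `0`. -/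
def nextTerm (N : IterationSystem) : Tm :=
  union (sep (pair empty (N.succ.inst (last (var 0))))
    (or (and (eq (var 1) empty) (eq (var 0) empty))
      (and (neg (eq (var 1) empty)) (eq (var 0) (N.succ.inst (last (var 0))).up))))

/-- The term for the successor of the variable `0` in the iteration system. -/
def succTerm (N : IterationSystem) : Tm :=
  cup (var 0) (single (cup (union (var 0)) (single (nextTerm N))))

theorem freeBelow_up {k : Kind} {e : Expr k} {n : ℕ} (h : e.FreeBelow n) :
    e.up.FreeBelow (n + 1) := by
  have : e.up = e.subst (fun i => var (i + 1)) := by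
    conv_lhs => rw [← subst_var e]
    exact rename_subst e var Nat.succ
  rw [this]
  exact h.subst fun i hi => Nat.succ_lt_succ hi

theorem freeBelow_succTerm (N : IterationSystem) : IsGlobalFun 1 (succTerm N) := by
  have h : (N.succ.inst (last (var 0))).FreeBelow 1 :=
    FreeBelow.inst N.succ_unary (by
      simp [last, field, ball, FreeBelow, up, Expr.rename])
  have h' := freeBelow_up h
  simp [IsGlobalFun, succTerm, nextTerm, cup, single, FreeBelow, h, h']

theorem freeBelow_iter {φ : Tm} (h : IsGlobalFun 1 φ) (n : ℕ) : IsGlobalFun 1 (iter φ n) := by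
  induction n with
  | zero => exact Nat.one_pos
  | succ n ih => exact FreeBelow.inst h ih

section SuccTerm

variable {M : Type} [SetStructure M] [Model M] {σ : M → M} {N : IterationSystem}

theorem tv_nextTerm (hσ : ∀ v : ℕ → M, tv v N.succ = σ (v 0)) (v : ℕ → M) (hL : LinOrd (v 0)) :
    tv v (nextTerm N) = nextOf σ (v 0) := by
  refine tv_union_sep_eq v _ _ fun y => ?_
  simp only [tv_pair, mem_sPair, tr_or, tr_and, tr_eq, tr_neg, tv_up, tv_inst, hσ, push_zero,
    push_one, tv_var, tv_empty]
  by_cases h : v 0 = sEmpty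
  · rw [nextOf_eq_empty (eq_empty_iff.1 h)]
    simp +contextual [h]
  · obtain ⟨l, hl⟩ := hL.exists_top (hL.union_mem (ne_empty_iff.1 h))
    rw [nextOf_eq hL hl, tv_last (t := var 0) hL hl]
    simp +contextual [h]

theorem tv_succTerm (hσ : ∀ v : ℕ → M, tv v N.succ = σ (v 0)) (v : ℕ → M) (hL : LinOrd (v 0)) :
    tv v (succTerm N) = sSucc σ (v 0) := by
  rw [succTerm, tv_cup, tv_single, tv_cup, tv_single, tv_nextTerm hσ v hL]; rfl

theorem tv_iter_succTerm (hσ : ∀ v : ℕ → M, tv v N.succ = σ (v 0)) (hσ' : ∀ x, x ε σ x)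
    (v : ℕ → M) (hL : Has σ (v 0)) (n : ℕ) :
    tv v (iter (succTerm N) n) = (sSucc σ)^[n] (v 0) := by
  induction n with
  | zero => rfl
  | succ n ih =>
    have h := (hL.succ_iterate hσ' n).linOrd
    rw [iter, tv_inst, tv_succTerm hσ _ (by rwa [push_zero, ih]), push_zero, ih,
      Function.iterate_succ_apply']

theorem Has.ceq_succ_iterate {L : M} (hL : Has σ L) (hσ' : ∀ x, x ε σ x) (n : ℕ) :
    Ceq (sAddOne^[n] L) ((sSucc σ)^[n] L) := by
  induction n with
  | zero => exact Ceq.refl L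
  | succ n ih =>
    rw [Function.iterate_succ_apply', Function.iterate_succ_apply']
    exact ih.addOne.trans (ceq_ins_addOne (last_seg_not_mem
      ((hL.succ_iterate hσ' n).nextOf_not_mem hσ'))).symm

end SuccTerm

/-! ### The three systems -/

section Systems

/-- If the field of `L` is transitive, it serves as the transitive set itself. -/
theorem exists_trans_of_field {M : Type} [SetStructure M] [Model M] {σ : M → M} {L : M}
    (h : Has σ L) (hσ : ∀ x, x ε σ x) (hT : IsTrans (sUnion L)) :
    ∃ T, IsTrans T ∧ Incl (sUnion L) T ∧ ¬ nextOf σ L ε T :=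
  ⟨sUnion L, hT, Incl.refl _, h.nextOf_not_mem hσ⟩

theorem sUnion_isTrans_of_segments {M : Type} [SetStructure M] [FiniteModel M] {L : M}
    (hL : LinOrd L) (h : ∀ W y, Top L W y → Incl y W) : IsTrans (sUnion L) := fun x hx y hy => by
  obtain ⟨W, hW⟩ := hL.exists_seg hx
  exact mem_sUnion_of_mem (h W x hW y hy) hW.seg_mem

theorem rankedSystem_VN : RankedSystem VN where
  zero_eq := rfl
  exists_fun M _ _ := by
    have hσ : ∀ x : M, x ε sCup x (sSingle x) := fun x => by simp
    refine ⟨fun x => sCup x (sSingle x), fun v => rfl, hσ, fun L hL => ?_⟩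
    refine exists_trans_of_field hL hσ (sUnion_isTrans_of_segments hL.linOrd fun W y hy => ?_)
    -- an initial segment with the last element `y` is `y ∪ {y}`
    have := hL.linOrd.induction_top (P := fun W => ∀ y, y ε W →
        (∀ V, V ε L → y ε V → Incl W V) → W = sCup y (sSingle y))
      ⟨ball (var 0) (imp (ball (var 2) (imp (mem (var 1) (var 0)) (sub (var 2) (var 0))))
        (eq (var 1) (cup (var 0) (single (var 0))))), fun _ => L, fun W => by simp⟩
      (fun a ha y hy _ => by
        obtain rfl := mem_sSingle.1 hy
        obtain rfl := Succession.first hL y ha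
        exact ext _ _ fun x => by simp)
      (fun W y z hy ih hz hzL u hu hu' => by
        obtain rfl := hL.linOrd.top_unique (hL.linOrd.top_ins hy.seg_mem hz hzL) ⟨hzL, hu, hu'⟩
        have hzy : z = sCup y (sSingle y) := Succession.next hL W y z hy hz hzL
        rw [show W = z from (ih y hy.mem hy.least).trans hzy.symm]; rfl) hy.seg_mem y hy.mem hy.least
    rw [this]
    exact fun x hx => by simp [hx]

theorem rankedSystem_Zermelo : RankedSystem Zermelo where
  zero_eq := rfl
  exists_fun M _ _ := by
    have hσ : ∀ x : M, x ε sSingle x := fun x => by simp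
    refine ⟨sSingle, fun v => rfl, hσ, fun L hL => ?_⟩
    refine exists_trans_of_field hL hσ (sUnion_isTrans_of_segments hL.linOrd fun W y hy => ?_)
    rcases hL.linOrd.seg_cases hy.seg_mem with ⟨a, rfl⟩ | ⟨V, z, hV, hz, rfl⟩
    · rw [mem_sSingle.1 hy.mem, Succession.first hL a hy.seg_mem]
      exact fun x hx => absurd hx not_mem_sEmpty
    · obtain rfl := hL.linOrd.top_unique hy (hL.linOrd.top_ins hV hz hy.seg_mem)
      obtain ⟨w, hw⟩ := hL.linOrd.exists_top hV
      rw [show y = sSingle w from Succession.next hL V w y hw hz hy.seg_mem]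
      exact fun x hx => mem_sIns.2 (Or.inl (mem_sSingle.1 hx ▸ hw.mem))

theorem rankedSystem_CH : RankedSystem CH where
  zero_eq := rfl
  exists_fun M _ _ := by
    have hσ : ∀ x : M, x ε sPow x := fun x => mem_sPow.2 (Incl.refl x)
    refine ⟨sPow, fun v => rfl, hσ, fun L hL => ?_⟩
    by_cases h : ∃ W, W ε L
    · obtain ⟨l, hl⟩ := hL.linOrd.exists_top (hL.linOrd.union_mem h)
      -- the last element `y` of an initial segment is transitive and includes its elements
      have := hL.linOrd.induction_top (P := fun W => ∀ y, y ε W →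
          (∀ V, V ε L → y ε V → Incl W V) → (∀ x, x ε y → Incl x y) ∧ ∀ x, x ε W → Incl x y)
        ⟨ball (var 0) (imp (ball (var 2) (imp (mem (var 1) (var 0)) (sub (var 2) (var 0))))
          (and (ball (var 0) (sub (var 0) (var 1))) (ball (var 1) (sub (var 0) (var 1))))),
          fun _ => L, fun W => by simp⟩
        (fun a ha y hy _ => by
          obtain rfl := mem_sSingle.1 hy
          obtain rfl := Succession.first hL y ha
          refine ⟨fun x hx => absurd hx not_mem_sEmpty, fun x hx => ?_⟩
          rw [mem_sSingle.1 hx]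
          exact Incl.refl _)
        (fun W y z hy ih hz hzL u hu hu' => by
          obtain rfl := hL.linOrd.top_unique (hL.linOrd.top_ins hy.seg_mem hz hzL) ⟨hzL, hu, hu'⟩
          obtain ⟨h1, h2⟩ := ih y hy.mem hy.least
          have hty : IsTrans y := h1
          have hzy : z = sPow y := Succession.next hL W y z hy hz hzL
          refine ⟨hzy ▸ hty.pow, fun x hx => ?_⟩
          rcases mem_sIns.1 hx with hx | rfl
          · rw [hzy]
            exact (h2 x hx).trans hty.incl_sPow
          · exact Incl.refl _) hl.seg_mem l hl.mem hl.least
      have htl : IsTrans l := this.1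
      refine ⟨sPow l, htl.pow, fun x hx => mem_sPow.2 (this.2 x hx), ?_⟩
      rw [nextOf_eq hL.linOrd hl]
      exact not_mem_self _
    · refine ⟨sEmpty, fun x hx => absurd hx not_mem_sEmpty, fun x hx => ?_, not_mem_sEmpty⟩
      obtain ⟨W, hW, -⟩ := mem_sUnion.1 hx
      exact absurd ⟨W, hW⟩ h

end Systems

/-! ### Completeness of the calculus -/

namespace Expr

/-- An injective numbering of the expressions of each kind. -/
def code : {k : Kind} → Expr k → ℕ
  | _, var i => Nat.pair 0 i
  | _, empty => Nat.pair 1 0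
  | _, pair s t => Nat.pair 2 (Nat.pair (code s) (code t))
  | _, pow s => Nat.pair 3 (code s)
  | _, union s => Nat.pair 4 (code s)
  | _, fan s => Nat.pair 5 (code s)
  | _, sep s A => Nat.pair 6 (Nat.pair (code s) (code A))
  | _, repl t s => Nat.pair 7 (Nat.pair (code t) (code s))
  | _, mem s t => Nat.pair 8 (Nat.pair (code s) (code t))
  | _, eq s t => Nat.pair 9 (Nat.pair (code s) (code t))
  | _, sub s t => Nat.pair 10 (Nat.pair (code s) (code t))
  | _, neg A => Nat.pair 11 (code A)
  | _, Expr.and A B => Nat.pair 12 (Nat.pair (code A) (code B))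
  | _, Expr.or A B => Nat.pair 13 (Nat.pair (code A) (code B))
  | _, imp A B => Nat.pair 14 (Nat.pair (code A) (code B))
  | _, all A => Nat.pair 15 (code A)
  | _, ex A => Nat.pair 16 (code A)

theorem code_injective {k : Kind} : Function.Injective (code : Expr k → ℕ) := by
  intro e
  induction e <;> intro e' h <;> cases e' <;> simp only [code, Nat.pair_eq_pair] at h <;>
    grind [Function.Injective]

theorem rename_eq_subst {k : Kind} (e : Expr k) (r : ℕ → ℕ) :
    e.rename r = e.subst fun i => var (r i) := by
  conv_lhs => rw [← subst_var e]
  exact rename_subst e var r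

end Expr

/-- A contradictory formula. -/
def bot : Fm true := neg (eq empty empty)

namespace Derives

variable {H : List (Fm true)} {A B : Fm true}

theorem cons (h : Derives H A) : Derives (B :: H) A := h.weaken (List.subset_cons_self _ _)

theorem contradiction (h : Derives H A) (h' : Derives H (neg A)) : Derives H bot :=
  negIntro h.cons h'.cons

theorem neg_of_bot (h : Derives (A :: H) bot) : Derives H (neg A) := negIntro (eqRefl empty) h

theorem of_neg_bot (h : Derives (neg A :: H) bot) : Derives H A := negNeg (neg_of_bot h)

theorem hyp_self : Derives (A :: H) A := hyp (List.mem_cons_self ..)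

/-- A variable that occurs neither in the hypotheses nor in `C` witnesses an existential
hypothesis consistently. -/
theorem bot_of_witness {C : Fm true} {m : ℕ} (hC : C.FreeBelow (m + 1))
    (hH : ∀ B ∈ H, B.FreeBelow m) (hex : ex C ∈ H) (h : Derives (C.inst (var m) :: H) bot) :
    Derives H bot := by
  let r : ℕ → ℕ := fun i => if i = m then 0 else i + 1
  have h1 := h.rename r
  have hr : ∀ i < m, r i = i + 1 := fun i hi => if_neg hi.ne
  have hCr : (C.inst (var m)).rename r = C := by
    rw [rename_inst, inst, subst_rename]
    conv_rhs => rw [← subst_var C]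
    refine subst_congr hC fun i hi => ?_
    cases i with
    | zero => simp [liftRen, scons, Expr.rename, r]
    | succ i => simp [liftRen, scons, hr i (by omega)]
  have hHr : H.map (Expr.rename r) = H.map up := List.map_congr_left fun B hB => by
    rw [up, rename_eq_subst, rename_eq_subst]
    exact subst_congr (hH B hB) fun i hi => congrArg var (hr i hi)
  rw [List.map_cons, hCr, hHr] at h1
  exact exElim (hyp hex) h1

end Derives

/-- A maximal consistent set of formulas in which existential formulas have witnesses. -/
structure Henkin (T : Set (Fm true)) : Prop where
  closed : ∀ (H : List (Fm true)) (A : Fm true), (∀ B ∈ H, B ∈ T) → Derives H A → A ∈ T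
  consistent : bot ∉ T
  complete : ∀ A, A ∈ T ∨ neg A ∈ T
  witness : ∀ C, ex C ∈ T → ∃ t, C.inst t ∈ T

theorem exists_extension {H : List (Fm true)} (hH : ¬ Derives H bot) (B : Fm true) :
    ∃ H', ¬ Derives H' bot ∧ H ⊆ H' ∧ (B ∈ H' ∨ neg B ∈ H') ∧
      ∀ C, B = ex C → B ∈ H' → ∃ t, C.inst t ∈ H' := by
  by_cases hB : Derives (B :: H) bot
  · refine ⟨neg B :: H, fun h => hH (hB.neg_of_bot.contradiction h.neg_of_bot),
      List.subset_cons_self _ _, Or.inr (List.mem_cons_self ..), ?_⟩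
    rintro C rfl hC
    exact absurd ((Derives.hyp hC).contradiction Derives.hyp_self) fun h =>
      hH (hB.neg_of_bot.contradiction h.neg_of_bot)
  · by_cases hex : ∃ C, B = ex C
    · obtain ⟨C, rfl⟩ := hex
      have hfree : ∀ H : List (Fm true), ∃ m, ∀ B ∈ H, B.FreeBelow m := fun H => by
        induction H with
        | nil => exact ⟨0, by simp⟩
        | cons A H ih =>
          obtain ⟨m, hm⟩ := ih
          obtain ⟨n, hn⟩ := exists_freeBelow A
          refine ⟨max m n, fun B hB => ?_⟩
          rcases List.mem_cons.1 hB with rfl | hB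
          exacts [hn.mono (le_max_right _ _), (hm B hB).mono (le_max_left _ _)]
      obtain ⟨m, hm⟩ := hfree (ex C :: H)
      refine ⟨C.inst (var m) :: ex C :: H, fun h => hB (Derives.bot_of_witness
        (hm _ (List.mem_cons_self ..)) hm (List.mem_cons_self ..) h), by simp, by simp, ?_⟩
      rintro C' h -
      obtain rfl := by simpa using h
      exact ⟨var m, List.mem_cons_self ..⟩
    · exact ⟨B :: H, hB, List.subset_cons_self _ _, Or.inl (List.mem_cons_self ..),
        fun C hC => absurd ⟨C, hC⟩ hex⟩

theorem exists_henkin {A : Fm true} (hA : ¬ Derives [A] bot) : ∃ T, Henkin T ∧ A ∈ T := by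
  have : Countable (Fm true) := code_injective.countable
  have : Nonempty (Fm true) := ⟨bot⟩
  obtain ⟨g, hg⟩ := exists_surjective_nat (Fm true)
  choose next hnext using fun (H : {H : List (Fm true) // ¬ Derives H bot}) (B : Fm true) =>
    exists_extension H.2 B
  let K : ℕ → {H : List (Fm true) // ¬ Derives H bot} := fun n =>
    Nat.rec ⟨[A], hA⟩ (fun n H => ⟨next H (g n), (hnext H (g n)).1⟩) n
  have hK : ∀ n, (K (n + 1)).1 = next (K n) (g n) := fun n => rfl
  have hmono : ∀ m n, m ≤ n → (K m).1 ⊆ (K n).1 := fun m n h => by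
    induction n, h using Nat.le_induction with
    | base => exact List.Subset.refl _
    | succ n _ ih => exact List.Subset.trans ih (hK n ▸ (hnext (K n) (g n)).2.1)
  let T : Set (Fm true) := {B | ∃ n, B ∈ (K n).1}
  have hfin : ∀ H : List (Fm true), (∀ B ∈ H, B ∈ T) → ∃ n, H ⊆ (K n).1 := fun H => by
    induction H with
    | nil => exact fun _ => ⟨0, by simp⟩
    | cons B H ih =>
      intro h
      obtain ⟨m, hm⟩ := h B (List.mem_cons_self ..)
      obtain ⟨n, hn⟩ := ih fun C hC => h C (List.mem_cons_of_mem _ hC)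
      refine ⟨max m n, List.cons_subset.2 ⟨hmono _ _ (le_max_left m n) hm, ?_⟩⟩
      exact List.Subset.trans hn (hmono _ _ (le_max_right m n))
  have hcomplete : ∀ B, B ∈ T ∨ neg B ∈ T := fun B => by
    obtain ⟨n, rfl⟩ := hg B
    exact (hnext (K n) (g n)).2.2.1.imp (fun h => ⟨n + 1, h⟩) fun h => ⟨n + 1, h⟩
  have hcons : ∀ H : List (Fm true), (∀ B ∈ H, B ∈ T) → ¬ Derives H bot := fun H hH h => by
    obtain ⟨n, hn⟩ := hfin H hH
    exact (K n).2 (h.weaken hn)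
  refine ⟨T, ⟨fun H B hH h => (hcomplete B).resolve_right fun h' => ?_, fun h => ?_, hcomplete,
    fun C hC => ?_⟩, 0, List.mem_cons_self ..⟩
  · refine hcons (neg B :: H) (fun C hC => ?_) (h.cons.contradiction Derives.hyp_self)
    rcases List.mem_cons.1 hC with rfl | hC
    exacts [h', hH C hC]
  · exact hcons [bot] (by simpa using h) Derives.hyp_self
  · obtain ⟨n, hn⟩ := hg (ex C)
    have hKn : (K (n + 1)).1 = next (K n) (ex C) := by rw [hK, hn]
    obtain ⟨-, -, h, hw⟩ := hnext (K n) (ex C)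
    rw [← hKn] at h hw
    have hCn : ex C ∈ (K (n + 1)).1 := h.resolve_right fun h => by
      refine hcons [ex C, neg (ex C)] (fun B hB => ?_) (Derives.hyp_self.contradiction
        Derives.hyp_self.cons)
      rcases List.mem_cons.1 hB with rfl | hB
      · exact hC
      · rw [List.mem_singleton.1 hB]
        exact ⟨n + 1, h⟩
    obtain ⟨t, ht⟩ := hw C rfl hCn
    exact ⟨t, n + 1, ht⟩

namespace Henkin

variable {T : Set (Fm true)} {A B : Fm true} {s t s' t' a : Tm}

theorem of_derives (hT : Henkin T) (hA : A ∈ T) (h : Derives [A] B) : B ∈ T :=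
  hT.closed [A] B (by simpa using hA) h

theorem of_derives₂ {C : Fm true} (hT : Henkin T) (hA : A ∈ T) (hB : B ∈ T)
    (h : Derives [A, B] C) : C ∈ T :=
  hT.closed [A, B] C (by simp [hA, hB]) h

theorem neg_iff (hT : Henkin T) : neg A ∈ T ↔ A ∉ T :=
  ⟨fun h h' => hT.consistent (hT.of_derives₂ h' h
    (Derives.hyp_self.contradiction Derives.hyp_self.cons)), fun h => (hT.complete A).resolve_left h⟩

theorem and_iff (hT : Henkin T) : (Expr.and A B : Fm true) ∈ T ↔ A ∈ T ∧ B ∈ T :=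
  ⟨fun h => ⟨hT.of_derives h Derives.hyp_self.andLeft, hT.of_derives h Derives.hyp_self.andRight⟩,
    fun h => hT.of_derives₂ h.1 h.2 (Derives.hyp_self.andIntro Derives.hyp_self.cons)⟩

theorem or_iff (hT : Henkin T) : (Expr.or A B : Fm true) ∈ T ↔ A ∈ T ∨ B ∈ T := by
  refine ⟨fun h => ?_, fun h => h.elim (fun h => hT.of_derives h Derives.hyp_self.orLeft)
    fun h => hT.of_derives h Derives.hyp_self.orRight⟩
  by_contra! h'
  rw [← hT.neg_iff, ← hT.neg_iff] at h'
  exact hT.consistent (hT.closed [Expr.or A B, neg A, neg B] bot (by simp [h, h'])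
    (.orElim Derives.hyp_self (Derives.hyp_self.contradiction (.hyp (by simp)))
      (Derives.hyp_self.contradiction (.hyp (by simp)))))

theorem imp_iff (hT : Henkin T) : imp A B ∈ T ↔ (A ∈ T → B ∈ T) := by
  refine ⟨fun h hA => hT.of_derives₂ h hA (Derives.hyp_self.impElim Derives.hyp_self.cons),
    fun h => ?_⟩
  by_cases hA : A ∈ T
  · exact hT.of_derives (h hA) (.impIntro Derives.hyp_self.cons)
  · exact hT.of_derives (hT.neg_iff.2 hA) (.impIntro (.of_neg_bot
      ((Derives.hyp (by simp)).contradiction (A := A) (.hyp (by simp)))))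

theorem ex_iff (hT : Henkin T) : ex A ∈ T ↔ ∃ t, A.inst t ∈ T :=
  ⟨hT.witness A, fun ⟨t, h⟩ => hT.of_derives h (.exIntro t Derives.hyp_self)⟩

theorem all_iff (hT : Henkin T) : all A ∈ T ↔ ∀ t, A.inst t ∈ T := by
  refine ⟨fun h t => hT.of_derives h (.allElim t Derives.hyp_self), fun h => ?_⟩
  by_contra h'
  rw [← hT.neg_iff] at h'
  -- `¬ ∀ x A` implies `∃ x ¬ A`, which has a witness
  have hex : ex (neg A) ∈ T := by
    refine hT.of_derives h' (.of_neg_bot (Derives.contradiction (A := all A) (.allIntro ?_)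
      Derives.hyp_self.cons))
    refine .of_neg_bot (Derives.contradiction (A := ex (rename (liftRen Nat.succ) (neg A)))
      (.exIntro (var 0) ?_) (.hyp (by simp [up, rename])))
    rw [inst_var_zero]
    exact Derives.hyp_self
  obtain ⟨t, ht⟩ := hT.witness _ hex
  exact hT.neg_iff.1 ht (h t)

theorem ax (hT : Henkin T) {A : Fm false} (h : EA0Axiom A) : A.toEA1 ∈ T :=
  hT.closed [] _ (by simp) (.ax h)

theorem sub_iff (hT : Henkin T) : sub s t ∈ T ↔ ∀ a, mem a s ∈ T → mem a t ∈ T := by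
  refine ⟨fun h a ha => ?_, fun h => ?_⟩
  · have := hT.ax (.subsetElim a s t)
    simp only [toEA1, hT.imp_iff, hT.and_iff] at this
    exact this ⟨h, ha⟩
  · have hall : all (imp (mem (var 0) s.up) (mem (var 0) t.up)) ∈ T := by
      refine hT.all_iff.2 fun a => hT.imp_iff.2 fun ha => ?_
      have hs : subst (scons a var) s.up = s := inst_up s a
      have ht : subst (scons a var) t.up = t := inst_up t a
      simp only [subst, hs, ht, scons] at ha ⊢
      exact h a ha
    refine hT.of_derives hall (.subIntro ?_)
    have h0 := Derives.allElim (var 0) (Derives.hyp_self (H := [])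
      (A := (all (imp (mem (var 0) s.up) (mem (var 0) t.up))).up))
    rwa [inst_var_zero] at h0

theorem eq_inst (hT : Henkin T) (A : Fm true) (h : eq s t ∈ T) (hA : A.inst s ∈ T) :
    A.inst t ∈ T :=
  hT.of_derives₂ h hA (.eqSubst A Derives.hyp_self Derives.hyp_self.cons)

theorem eq_refl (hT : Henkin T) (t : Tm) : eq t t ∈ T := hT.closed [] _ (by simp) (.eqRefl t)

theorem eq_symm (hT : Henkin T) (h : eq s t ∈ T) : eq t s ∈ T := by
  have hs : ∀ a, subst (scons a var) s.up = s := inst_up s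
  simpa only [inst, subst, scons, hs] using
    hT.eq_inst (eq (var 0) s.up) h (by simpa only [inst, subst, scons, hs] using hT.eq_refl s)

theorem eq_trans (hT : Henkin T) (h : eq s t ∈ T) (h' : eq t a ∈ T) : eq s a ∈ T := by
  have hs : ∀ a, subst (scons a var) s.up = s := inst_up s
  simpa only [inst, subst, scons, hs] using
    hT.eq_inst (eq s.up (var 0)) h' (by simpa only [inst, subst, scons, hs] using h)

theorem mem_congr (hT : Henkin T) (h : eq s s' ∈ T) (h' : eq t t' ∈ T) (hm : mem s t ∈ T) :
    mem s' t' ∈ T := by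
  have ht : ∀ a, subst (scons a var) t.up = t := inst_up t
  have hs : ∀ a, subst (scons a var) s'.up = s' := inst_up s'
  have h1 : mem s' t ∈ T := by
    simpa only [inst, subst, scons, ht] using
      hT.eq_inst (mem (var 0) t.up) h (by simpa only [inst, subst, scons, ht] using hm)
  simpa only [inst, subst, scons, hs] using
    hT.eq_inst (mem s'.up (var 0)) h' (by simpa only [inst, subst, scons, hs] using h1)

theorem fan_congr (hT : Henkin T) (h : eq s t ∈ T) : eq (fan s) (fan t) ∈ T := by
  have hs : ∀ a, subst (scons a var) s.up = s := inst_up s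
  simpa only [inst, subst, scons, hs] using
    hT.eq_inst (eq (fan s.up) (fan (var 0))) h
      (by simpa only [inst, subst, scons, hs] using hT.eq_refl (fan s))

/-- Equality of terms according to a Henkin set. -/
def setoid (hT : Henkin T) : Setoid Tm where
  r s t := eq s t ∈ T
  iseqv := ⟨hT.eq_refl, hT.eq_symm, hT.eq_trans⟩

/-- The term model of a Henkin set. -/
def TermModel (hT : Henkin T) : Type := Quotient hT.setoid

/-- The class of a term. -/
def cls (hT : Henkin T) (t : Tm) : hT.TermModel := Quotient.mk hT.setoid t

theorem exists_rep (hT : Henkin T) (a : hT.TermModel) : ∃ t, hT.cls t = a := Quotient.exists_rep a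

theorem cls_eq_iff (hT : Henkin T) : hT.cls s = hT.cls t ↔ eq s t ∈ T :=
  ⟨fun h => Quotient.exact h, fun h => Quotient.sound (s := hT.setoid) h⟩

instance (hT : Henkin T) : SetStructure hT.TermModel where
  mem := Quotient.lift₂ (fun s t => mem s t ∈ T) fun _ _ _ _ h h' =>
    propext ⟨hT.mem_congr h h', hT.mem_congr (hT.eq_symm h) (hT.eq_symm h')⟩
  fan := Quotient.lift (fun s => hT.cls (fan s)) fun _ _ h => hT.cls_eq_iff.2 (hT.fan_congr h)
  default := hT.cls empty

theorem cls_mem_iff (hT : Henkin T) : hT.cls s ε hT.cls t ↔ mem s t ∈ T := Iff.rfl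

theorem fan_cls (hT : Henkin T) : SetStructure.fan (hT.cls s) = hT.cls (fan s) := rfl

theorem ext (hT : Henkin T) {a b : hT.TermModel} (h : ∀ x, x ε a ↔ x ε b) : a = b := by
  obtain ⟨s, rfl⟩ := hT.exists_rep a
  obtain ⟨t, rfl⟩ := hT.exists_rep b
  rw [cls_eq_iff]
  have := hT.ax (.extensionality s t)
  simp only [toEA1, hT.imp_iff, hT.and_iff, hT.sub_iff] at this
  exact this ⟨fun a => (h (hT.cls a)).1, fun a => (h (hT.cls a)).2⟩

theorem theSet_eq (hT : Henkin T) {P : hT.TermModel → Prop}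
    (h : ∀ a, mem a t ∈ T ↔ P (hT.cls a)) : theSet P = hT.cls t := by
  have h' : ∀ x, x ε hT.cls t ↔ P x := fun x => by
    obtain ⟨a, rfl⟩ := hT.exists_rep x
    exact h a
  exact hT.ext fun x => by rw [mem_theSet ⟨_, h'⟩, h']

theorem mem_sep_iff (hT : Henkin T) (A : Fm false) :
    mem a (sep s A) ∈ T ↔ mem a s ∈ T ∧ (A.inst a).toEA1 ∈ T := by
  have := hT.ax (.subsetSelection a s A)
  simp only [iff, toEA1, hT.imp_iff, hT.and_iff] at this
  exact ⟨fun h => this.1 h, fun h => this.2 h⟩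

theorem bex_iff (hT : Henkin T) (A : Fm false) :
    (bex s A : Fm true) ∈ T ↔ ∃ a, mem a s ∈ T ∧ (A.inst a).toEA1 ∈ T := by
  simp only [bex, ball, hT.neg_iff, hT.sub_iff, hT.mem_sep_iff]
  simp only [inst, subst, toEA1, hT.neg_iff]
  push Not
  exact exists_congr fun a => ⟨fun h => ⟨h.1, h.2 h.1⟩, fun h => ⟨h.1, fun _ => h.2⟩⟩

theorem mem_empty_iff (hT : Henkin T) : mem a empty ∈ T ↔ False := by
  have := hT.ax (.emptySet a)
  simp only [toEA1, hT.neg_iff] at this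
  exact iff_false_intro this

theorem mem_pair_iff (hT : Henkin T) : mem a (pair s t) ∈ T ↔ eq a s ∈ T ∨ eq a t ∈ T := by
  have := hT.ax (.pairSet a s t)
  simp only [iff, toEA1, hT.imp_iff, hT.and_iff, hT.or_iff] at this
  exact ⟨this.1, this.2⟩

theorem mem_pow_iff (hT : Henkin T) : mem a (pow s) ∈ T ↔ sub a s ∈ T := by
  have := hT.ax (.powerSet a s)
  simp only [iff, toEA1, hT.imp_iff, hT.and_iff] at this
  exact ⟨this.1, this.2⟩

theorem mem_union_iff (hT : Henkin T) :
    mem a (union s) ∈ T ↔ ∃ x, mem x s ∈ T ∧ mem a x ∈ T := by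
  have := hT.ax (.unionSet a s)
  have ha : ∀ x, subst (scons x var) a.up = a := inst_up a
  have hb : toEA1 (bex s (mem a.up (var 0))) = bex s (mem a.up (var 0)) := by
    simp only [bex, ball, toEA1]
  simp only [iff, toEA1, hb, hT.imp_iff, hT.and_iff, hT.bex_iff] at this
  simp only [inst, subst, toEA1, ha, scons] at this
  exact ⟨this.1, this.2⟩

theorem mem_repl_iff (hT : Henkin T) :
    mem a (repl t s) ∈ T ↔ ∃ x, mem x s ∈ T ∧ eq a (t.inst x) ∈ T := by
  have := hT.ax (.replacement a s t)
  have ha : ∀ x, subst (scons x var) a.up = a := inst_up a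
  have hb : toEA1 (bex s (eq a.up t)) = bex s (eq a.up t) := by
    simp only [bex, ball, toEA1]
  simp only [iff, toEA1, hb, hT.imp_iff, hT.and_iff, hT.bex_iff] at this
  simp only [inst, subst, toEA1, ha] at this
  exact ⟨this.1, this.2⟩

theorem incl_iff (hT : Henkin T) : Incl (hT.cls s) (hT.cls t) ↔ sub s t ∈ T := by
  rw [hT.sub_iff]
  refine ⟨fun h a => h (hT.cls a), fun h x => ?_⟩
  obtain ⟨a, rfl⟩ := hT.exists_rep x
  exact h a

/-- A formula of either theory as a formula of `EA₁`. -/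
def full : {b : Bool} → Fm b → Fm true
  | true, A => A
  | false, A => A.toEA1

theorem cls_push (hT : Henkin T) (a : Tm) (f : ℕ → Tm) :
    hT.cls a ∷ (fun i => hT.cls (f i)) = fun i => hT.cls (scons a f i) := by
  funext i; cases i <;> rfl

/-- The property of an expression that its value in the term model is given by substitution. -/
def Truth (hT : Henkin T) : {k : Kind} → Expr k → Prop
  | Kind.term, t => ∀ f : ℕ → Tm, tv (fun i => hT.cls (f i)) t = hT.cls (subst f t)
  | Kind.formula _, A => ∀ f : ℕ → Tm, tr (fun i => hT.cls (f i)) A ↔ full (subst f A) ∈ T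

theorem truth (hT : Henkin T) {k : Kind} (e : Expr k) : hT.Truth e := by
  induction e with
  | var i => exact fun f => rfl
  | empty => exact fun f => hT.theSet_eq fun a => hT.mem_empty_iff
  | pair s t ihs iht =>
    intro f
    rw [tv_pair, ihs f, iht f]
    exact hT.theSet_eq fun a => by rw [subst, hT.mem_pair_iff, cls_eq_iff, cls_eq_iff]
  | pow s ih =>
    intro f
    rw [tv_pow, ih f]
    exact hT.theSet_eq fun a => by rw [subst, hT.mem_pow_iff, incl_iff]
  | union s ih =>
    intro f
    rw [tv_union, ih f]
    refine hT.theSet_eq fun a => ?_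
    rw [subst, hT.mem_union_iff]
    refine ⟨fun ⟨x, h⟩ => ⟨hT.cls x, h⟩, fun ⟨y, h⟩ => ?_⟩
    obtain ⟨x, rfl⟩ := hT.exists_rep y
    exact ⟨x, h⟩
  | fan s ih =>
    intro f
    rw [tv_fan, ih f, fan_cls, subst]
  | sep s A ihs ihA =>
    intro f
    rw [tv_sep, ihs f]
    refine hT.theSet_eq fun a => ?_
    rw [subst, hT.mem_sep_iff, inst_subst_liftSub]
    beta_reduce
    rw [cls_push, cls_mem_iff]
    exact and_congr_right fun _ => (ihA (scons a f)).symm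
  | repl t s iht ihs =>
    intro f
    rw [tv_repl, ihs f]
    refine hT.theSet_eq fun a => ?_
    rw [subst, hT.mem_repl_iff]
    constructor
    · rintro ⟨x, hx, h⟩
      refine ⟨hT.cls x, hx, ?_⟩
      beta_reduce
      rw [cls_push, iht, cls_eq_iff]
      rwa [inst_subst_liftSub] at h
    · rintro ⟨y, hy, h⟩
      obtain ⟨x, rfl⟩ := hT.exists_rep y
      beta_reduce at h
      rw [cls_push, iht, cls_eq_iff] at h
      exact ⟨x, hy, by rwa [inst_subst_liftSub]⟩
  | @mem b s t ihs iht =>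
    intro f
    rw [tr_mem, ihs f, iht f, cls_mem_iff]
    cases b <;> simp only [full, subst, toEA1]
  | @eq b s t ihs iht =>
    intro f
    rw [tr_eq, ihs f, iht f, cls_eq_iff]
    cases b <;> simp only [full, subst, toEA1]
  | @sub b s t ihs iht =>
    intro f
    rw [tr_sub, ihs f, iht f, incl_iff]
    cases b <;> simp only [full, subst, toEA1]
  | @neg b A ih =>
    intro f
    rw [tr_neg, ih f, ← hT.neg_iff]
    cases b <;> simp only [full, subst, toEA1]
  | @and b A B ihA ihB =>
    intro f
    rw [tr_and, ihA f, ihB f, ← hT.and_iff]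
    cases b <;> simp only [full, subst, toEA1]
  | @or b A B ihA ihB =>
    intro f
    rw [tr_or, ihA f, ihB f, ← hT.or_iff]
    cases b <;> simp only [full, subst, toEA1]
  | @imp b A B ihA ihB =>
    intro f
    rw [tr_imp, ihA f, ihB f, ← hT.imp_iff]
    cases b <;> simp only [full, subst, toEA1]
  | all A ih =>
    intro f
    simp only [tr_all, full, subst, hT.all_iff, inst_subst_liftSub]
    constructor
    · intro h a
      have := h (hT.cls a)
      rw [cls_push] at this
      exact (ih (scons a f)).1 this
    · intro h x
      obtain ⟨a, rfl⟩ := hT.exists_rep x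
      rw [cls_push]
      exact (ih (scons a f)).2 (h a)
  | ex A ih =>
    intro f
    simp only [tr_ex, full, subst, hT.ex_iff, inst_subst_liftSub]
    constructor
    · rintro ⟨x, h⟩
      obtain ⟨a, rfl⟩ := hT.exists_rep x
      rw [cls_push] at h
      exact ⟨a, (ih (scons a f)).1 h⟩
    · rintro ⟨a, h⟩
      refine ⟨hT.cls a, ?_⟩
      rw [cls_push]
      exact (ih (scons a f)).2 h

theorem tv_cls (hT : Henkin T) (t : Tm) : tv (fun i => hT.cls (var i)) t = hT.cls t :=
  (hT.truth t var).trans (by rw [subst_var])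

theorem tr_cls (hT : Henkin T) {b : Bool} (A : Fm b) :
    tr (fun i => hT.cls (var i)) A ↔ full A ∈ T := by
  rw [hT.truth A var, subst_var]

theorem tr_of_ax (hT : Henkin T) {A : Fm false} (h : EA0Axiom A) :
    tr (fun i => hT.cls (var i)) A :=
  (hT.tr_cls A).2 (hT.ax h)

theorem exists_assignment (hT : Henkin T) (v : ℕ → hT.TermModel) :
    ∃ f : ℕ → Tm, v = fun i => hT.cls (f i) := by
  choose f hf using fun i => hT.exists_rep (v i)
  exact ⟨f, funext fun i => (hf i).symm⟩

instance (hT : Henkin T) : BaseModel hT.TermModel where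
  ext _ _ h := hT.ext h
  exists_empty := ⟨hT.cls empty, fun x h => by
    obtain ⟨a, rfl⟩ := hT.exists_rep x
    exact hT.mem_empty_iff.1 h⟩
  exists_pair a b := by
    obtain ⟨s, rfl⟩ := hT.exists_rep a
    obtain ⟨t, rfl⟩ := hT.exists_rep b
    refine ⟨hT.cls (pair s t), fun x => ?_⟩
    obtain ⟨a, rfl⟩ := hT.exists_rep x
    rw [cls_mem_iff, hT.mem_pair_iff, cls_eq_iff, cls_eq_iff]
  exists_pow a := by
    obtain ⟨s, rfl⟩ := hT.exists_rep a
    refine ⟨hT.cls (pow s), fun x => ?_⟩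
    obtain ⟨a, rfl⟩ := hT.exists_rep x
    rw [cls_mem_iff, hT.mem_pow_iff, incl_iff]
  exists_union a := by
    obtain ⟨s, rfl⟩ := hT.exists_rep a
    refine ⟨hT.cls (union s), fun x => ?_⟩
    obtain ⟨a, rfl⟩ := hT.exists_rep x
    rw [cls_mem_iff, hT.mem_union_iff]
    refine ⟨fun ⟨x, h⟩ => ⟨hT.cls x, h⟩, fun ⟨y, h⟩ => ?_⟩
    obtain ⟨x, rfl⟩ := hT.exists_rep y
    exact ⟨x, h⟩
  exists_sep a A v := by
    obtain ⟨s, rfl⟩ := hT.exists_rep a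
    obtain ⟨f, rfl⟩ := hT.exists_assignment v
    refine ⟨hT.cls (sep s (subst (liftSub f) A)), fun x => ?_⟩
    obtain ⟨a, rfl⟩ := hT.exists_rep x
    rw [cls_mem_iff, hT.mem_sep_iff, inst_subst_liftSub, cls_push, cls_mem_iff]
    exact and_congr_right fun _ => (hT.truth A (scons a f)).symm
  exists_repl a t v := by
    obtain ⟨s, rfl⟩ := hT.exists_rep a
    obtain ⟨f, rfl⟩ := hT.exists_assignment v
    refine ⟨hT.cls (repl (subst (liftSub f) t) s), fun x => ?_⟩
    obtain ⟨a, rfl⟩ := hT.exists_rep x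
    rw [cls_mem_iff, hT.mem_repl_iff]
    have key : ∀ x, hT.cls a = tv (hT.cls x ∷ fun i => hT.cls (f i)) t ↔
        eq a ((subst (liftSub f) t).inst x) ∈ T := fun x => by
      rw [cls_push, hT.truth t, cls_eq_iff, inst_subst_liftSub]
    constructor
    · rintro ⟨x, hx, h⟩
      exact ⟨hT.cls x, hx, (key x).2 h⟩
    · rintro ⟨y, hy, h⟩
      obtain ⟨x, rfl⟩ := hT.exists_rep y
      exact ⟨x, hy, (key x).1 h⟩

instance (hT : Henkin T) : FiniteModel hT.TermModel where
  dedekind a b h hc := by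
    obtain ⟨s, rfl⟩ := hT.exists_rep a
    obtain ⟨t, rfl⟩ := hT.exists_rep b
    by_contra hne
    have := hT.tr_of_ax (.dedekindFiniteness s t)
    rw [tr_imp, ssub_iff, tr_clt, hT.tv_cls, hT.tv_cls] at this
    exact (this ⟨h, hne⟩).2 hc

theorem termModel_mem_fan (hT : Henkin T) (a s : hT.TermModel) :
    a ε SetStructure.fan s ↔ Chain a s := by
  obtain ⟨a, rfl⟩ := hT.exists_rep a
  obtain ⟨s, rfl⟩ := hT.exists_rep s
  have := hT.tr_of_ax (.epsilonFan a s)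
  rwa [tr_iff, tr_mem, tr_isChain, tv_fan, hT.tv_cls, hT.tv_cls] at this

instance (hT : Henkin T) : Model hT.TermModel where
  mem_fan := hT.termModel_mem_fan
  foundation a b h h' := by
    obtain ⟨s, rfl⟩ := hT.exists_rep a
    obtain ⟨t, rfl⟩ := hT.exists_rep b
    have := hT.tr_of_ax (.foundation s t)
    rw [tr_imp, tr_neg, tr_mem, tr_mem, mem_tv_tc hT.termModel_mem_fan,
      mem_tv_tc hT.termModel_mem_fan, hT.tv_cls, hT.tv_cls] at this
    exact this h h'

end Henkin

/-- Completeness: a formula that is true in all models is provable. -/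
theorem provable_of_forall_model {A : Fm true}
    (h : ∀ (M : Type) [SetStructure M] [Model M] (v : ℕ → M), tr v A) : Provable A := by
  by_contra hA
  obtain ⟨T, hT, hmem⟩ := exists_henkin (A := neg A) fun h => hA h.of_neg_bot
  exact hT.neg_iff.1 hmem ((hT.tr_cls A).1 (h hT.TermModel _))

/-- The axioms are true in the models. -/
theorem Model.tr_of_ax {M : Type} [SetStructure M] [Model M] {A : Fm false} (h : EA0Axiom A)
    (v : ℕ → M) : tr v A := by
  cases h with
  | emptySet a => simp
  | pairSet a s t => simp
  | powerSet a s => simp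
  | unionSet a s => simp
  | subsetSelection a s A => simp
  | replacement a s t => simp
  | subsetElim a s t => exact fun h => h.1 _ h.2
  | extensionality s t => exact fun h => h.1.antisymm h.2
  | dedekindFiniteness s t =>
    rw [tr_imp, ssub_iff, tr_clt]
    exact fun h => ⟨Cle.of_sub h.1, fun h' => h.2 (FiniteModel.dedekind _ _ h.1 h')⟩
  | epsilonFan a s =>
    rw [tr_iff, tr_mem, tr_isChain, tv_fan]
    exact Model.mem_fan _ _
  | foundation s t =>
    rw [tr_imp, tr_neg, tr_mem, tr_mem, mem_tv_tc Model.mem_fan, mem_tv_tc Model.mem_fan]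
    exact Model.foundation _ _

theorem Provable.tr {A : Fm true} (h : Provable A) {M : Type} [SetStructure M] [Model M]
    (v : ℕ → M) : tr v A :=
  Derives.sound (fun _ h v => Model.tr_of_ax h v) h v (by simp)

/-! ### Cardinalities in the metatheory -/

section Card

variable {M : Type} [SetStructure M] [BaseModel M] {a b x : M}

/-- The set of the members of `a`. -/
def members (a : M) : Set M := {x | x ε a}

theorem Ceq.ncard_eq (h : Ceq a b) : (members a).ncard = (members b).ncard := by
  obtain ⟨f, hf, hs⟩ := h
  choose g hg hgf using hf.total
  refine Set.ncard_congr g (fun x hx => hg x hx) (fun x y hx hy h => ?_) fun y hy => ?_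
  · exact hf.injective x y _ hx hy (hg x hx) (hgf x hx) (h ▸ hgf y hy)
  · obtain ⟨x, hx, hxy⟩ := hs y hy
    exact ⟨x, hx, hf.functional x _ _ hx (hg x hx) hy (hgf x hx) hxy⟩

theorem members_sIns : members (sIns a x) = insert x (members a) :=
  Set.ext fun y => by simp [members, or_comm]

theorem ncard_members_sAdd (ha : (members a).Finite) (hb : (members b).Finite) :
    (members (sAdd a b)).ncard = (members a).ncard + (members b).ncard := by
  have h : members (sAdd a b) =
      (sOpair · sEmpty) '' members a ∪ (sOpair · sOne) '' members b := by
    ext x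
    simp only [members, Set.mem_ofPred_eq, mem_sAdd, Set.mem_union, Set.mem_image, eq_comm]
  rw [h, Set.ncard_union_eq _ (ha.image _) (hb.image _), Set.ncard_image_of_injective,
    Set.ncard_image_of_injective]
  · exact fun x y h => (sOpair_inj.1 h).1
  · exact fun x y h => (sOpair_inj.1 h).1
  · rw [Set.disjoint_left]
    rintro _ ⟨x, -, rfl⟩ ⟨y, -, h⟩
    exact sEmpty_ne_sOne (sOpair_inj.1 h).2.symm

theorem ncard_succ_iterate {M : Type} [SetStructure M] [Model M] {σ : M → M} {L : M}
    (h : Has σ L) (hσ : ∀ x, x ε σ x) (hL : (members L).Finite) (n : ℕ) :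
    (members ((sSucc σ)^[n] L)).Finite ∧
      (members ((sSucc σ)^[n] L)).ncard = (members L).ncard + n := by
  induction n with
  | zero => exact ⟨hL, rfl⟩
  | succ n ih =>
    rw [Function.iterate_succ_apply', sSucc, sAppend, members_sIns]
    refine ⟨ih.1.insert _, ?_⟩
    rw [Set.ncard_insert_of_notMem _ ih.1, ih.2, add_assoc]
    exact last_seg_not_mem ((h.succ_iterate hσ n).nextOf_not_mem hσ)

end Card

/-! ### The hereditarily finite sets -/

/-- Ackermann's coding of the hereditarily finite sets by natural numbers: the members of `a` are
the positions of the digits `1` in the binary expansion of `a`. -/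
@[ext] structure HF where
  /-- The number that codes the set. -/
  code : ℕ

namespace HF

/-- The membership relation on codes, with an arbitrary function in the place of the fan. -/
@[reducible] def structureWith (f : HF → HF) : SetStructure HF where
  mem a b := b.code.testBit a.code = true
  fan := f
  default := ⟨0⟩

/-- Every bounded set of codes has a code. -/
theorem exists_code (P : HF → Prop) (n : ℕ) (h : ∀ a, P a → a.code < n) :
    ∃ z : HF, ∀ a : HF, z.code.testBit a.code = true ↔ P a := by
  induction n generalizing P with
  | zero => exact ⟨⟨0⟩, fun a => by simpa using fun ha => absurd (h a ha) (Nat.not_lt_zero _)⟩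
  | succ n ih =>
    obtain ⟨⟨z⟩, hz⟩ := ih (fun a => P a ∧ a.code < n) fun a ha => ha.2
    by_cases hn : P ⟨n⟩
    · refine ⟨⟨z ||| 2 ^ n⟩, fun a => ?_⟩
      rw [Nat.testBit_or, Bool.or_eq_true, hz, Nat.testBit_two_pow, decide_eq_true_iff]
      constructor
      · rintro (h | rfl)
        exacts [h.1, hn]
      · intro ha
        have := h a ha
        by_cases h' : a.code = n
        exacts [Or.inr h'.symm, Or.inl ⟨ha, by omega⟩]
    · refine ⟨⟨z⟩, fun a => (hz a).trans ⟨fun h => h.1, fun ha => ⟨ha, ?_⟩⟩⟩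
      have := h a ha
      have : a.code ≠ n := by rintro rfl; exact hn ha
      omega

section

variable (f : HF → HF)

theorem code_lt {a b : HF} (h : (structureWith f).mem a b) : a.code < b.code :=
  lt_of_lt_of_le Nat.lt_two_pow_self (Nat.ge_two_pow_of_testBit h)

theorem baseModel : @BaseModel HF (structureWith f) :=
  let _ := structureWith f
  { ext := fun a b h => HF.ext (by
      refine Nat.eq_of_testBit_eq fun i => Bool.eq_iff_iff.2 (h ⟨i⟩))
    exists_empty := ⟨⟨0⟩, fun x h => by simpa using (show Nat.testBit 0 x.code = true from h)⟩
    exists_pair := fun a b => exists_code _ (a.code + b.code + 1) fun x h => by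
      rcases h with rfl | rfl <;> omega
    exists_pow := fun a => exists_code _ (a.code + 1) fun x h => by
      have hx : x.code &&& a.code = x.code := Nat.eq_of_testBit_eq fun i => by
        rw [Nat.testBit_and, Bool.and_eq_left_iff_imp]
        exact h ⟨i⟩
      exact Nat.lt_succ_of_le (hx ▸ Nat.and_le_right)
    exists_union := fun a => exists_code _ a.code
      fun x ⟨_, hy, hx⟩ => (code_lt f hx).trans (code_lt f hy)
    exists_sep := fun a A v => exists_code _ a.code fun x h => code_lt f h.1
    exists_repl := fun a t v => exists_code _
      ((Finset.range a.code).sup (fun y => (tv (⟨y⟩ ∷ v) t).code) + 1)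
      fun x ⟨y, hy, hx⟩ => Nat.lt_succ_of_le (hx ▸ Finset.le_sup
        (f := fun y => (tv (⟨y⟩ ∷ v) t).code) (Finset.mem_range.2 (code_lt f hy))) }

theorem finite_members (a : HF) : (@members HF (structureWith f) a).Finite :=
  Set.Finite.of_injOn (f := code) (t := Set.Iio a.code) (fun _ hx => code_lt f hx)
    (fun _ _ _ _ h => HF.ext h) (Set.finite_Iio _)

theorem finiteModel : @FiniteModel HF (structureWith f) :=
  let _ := structureWith f
  { baseModel f with
    dedekind := fun a b h hc => by
      have := baseModel f
      have h' : members a = members b :=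
        Set.eq_of_subset_of_ncard_le (s := members a) h hc.ncard_eq.ge (finite_members f b)
      exact BaseModel.ext a b fun x => Set.ext_iff.1 h' x }

/-- The field of an `∈`-chain for `s` consists of sets with codes less than that of `s`. -/
theorem code_lt_of_chain {C s T : HF} (hC : @Chain HF (structureWith f) C s)
    (hT : ∀ x, (structureWith f).mem x T ↔ x.code < s.code) :
    ∀ W, (structureWith f).mem W C → @Incl HF (structureWith f) W T := by
  let _ := structureWith f
  have := finiteModel f
  exact hC.field_incl (fun x hx => (hT x).2 (code_lt f hx)) fun x hx y hy =>
    (hT y).2 ((code_lt f hy).trans ((hT x).1 hx))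

theorem exists_fan (s : HF) : ∃ z : HF, ∀ C, (structureWith f).mem C z ↔
    @Chain HF (structureWith f) C s := by
  let _ := structureWith f
  have := finiteModel f
  obtain ⟨T, hT⟩ := exists_code (fun x => x.code < s.code) s.code fun _ h => h
  refine exists_code _ (sPow (sPow T)).code fun C hC => code_lt f ?_
  exact mem_sPow.2 fun W hW => mem_sPow.2 (code_lt_of_chain f hC hT W hW)

end

/-- Being an `∈`-chain does not depend on the interpretation of the fan. -/
theorem chain_of_chain {f g : HF → HF} {C s : HF} (h : @Chain HF (structureWith f) C s) :
    @Chain HF (structureWith g) C s := by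
  obtain ⟨⟨⟨h1, h2, h3, h4⟩, h5, h6⟩, h7⟩ := h
  let _ := structureWith g
  refine ⟨⟨⟨h1, h2, h3, h4⟩, h5, fun W y z hy => h6 W y z ?_⟩, h7⟩
  obtain ⟨hy1, hy2, hy3⟩ := hy
  exact @Top.mk HF (structureWith f) C W y hy1 hy2 hy3

/-- The epsilon fan of a hereditarily finite set. -/
noncomputable def trueFan (s : HF) : HF := (exists_fan id s).choose

noncomputable instance : SetStructure HF := structureWith trueFan

instance : Model HF where
  toFiniteModel := finiteModel trueFan
  mem_fan a s := ((exists_fan id s).choose_spec a).trans ⟨chain_of_chain, chain_of_chain⟩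
  foundation := by
    have key : ∀ {a b : HF}, InTC a b → a.code < b.code := by
      rintro a b ⟨C, hC, ha⟩
      obtain ⟨T, hT⟩ := exists_code (fun x => x.code < b.code) b.code fun _ h => h
      have := finiteModel trueFan
      obtain ⟨W, hW, ha⟩ := mem_sUnion.1 ha
      exact (hT a).1 (code_lt_of_chain trueFan hC hT W hW a ha)
    exact fun a b h h' => lt_asymm (key h) (key h')

end HF

/-! ### The natural number systems in `EA₁` -/

section Final

variable {N : IterationSystem}

theorem RankedSystem.isNatSystem (hN : RankedSystem N) : N.IsNatSystem :=
  provable_of_forall_model fun M _ _ v => by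
    obtain ⟨σ, hσ, hσ', -⟩ := hN.exists_fun M
    simp only [tr_all, tr_imp, tr_isLinOrd, tr_has hN.zero_eq hσ, tr_neg, tr_mem, tv_inst, hσ,
      push_zero, tv_var, field, tv_union]
    intro L hL hNL h
    obtain ⟨W, hW, -⟩ := mem_sUnion.1 h
    obtain ⟨l, hl⟩ := hL.exists_top (hL.union_mem ⟨W, hW⟩)
    rw [tv_last (t := var 0) (v := L ∷ v) hL hl] at h
    exact hNL.not_mem_field hσ' hl h

theorem isGlobalFun_addOne : IsGlobalFun 1 addOne := by
  simp [IsGlobalFun, addOne, cadd, cup, prod, opair, single, numeral, csucc, FreeBelow, up,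
    Expr.rename]

theorem isArithmetical_addOne : IsArithmetical addOne :=
  ⟨isGlobalFun_addOne, provable_of_forall_model fun M _ _ v => by
    simp only [tr_all, tr_imp, tr_ceq, tv_inst, tv_addOne, tv_var, push_zero, push_one]
    exact fun _ _ h => h.addOne⟩

theorem isIncreasing_addOne : IsIncreasing addOne :=
  provable_of_forall_model fun M _ _ v => by
    simp only [tr_all, tr_imp, tr_cle, tv_inst, tv_addOne, tv_var, push_zero, push_one]
    exact fun _ _ h => h.addOne

/-- The system is closed under each function that adds a fixed number of elements. -/
theorem RankedSystem.closedUnder (hN : RankedSystem N) {φ : Tm} {n : ℕ}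
    (hφ : ∀ (M : Type) [SetStructure M] [Model M] (v : ℕ → M), tv v φ = sAddOne^[n] (v 0)) :
    ClosedUnder N φ :=
  ⟨iter (succTerm N) n, freeBelow_iter (freeBelow_succTerm N) n,
    provable_of_forall_model fun M _ _ v => by
      obtain ⟨σ, hσ, hσ', -⟩ := hN.exists_fun M
      simp only [tr_all, tr_imp, tr_and, tr_has hN.zero_eq hσ, tr_ceq, tv_inst, tv_var, push_zero,
        hφ]
      intro L hL
      rw [tv_iter_succTerm hσ hσ' _ hL]
      exact ⟨hL.succ_iterate hσ' n, hL.ceq_succ_iterate hσ' n⟩⟩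

theorem RankedSystem.exists_dominates (hN : RankedSystem N) {ψ : Tm} (hψ : ClosedUnder N ψ) :
    ∃ n, EventuallyDominatesOn N ψ (iter addOne n) := by
  obtain ⟨η, hη, hp⟩ := hψ
  obtain ⟨m, hm⟩ := exists_bound η 1 hη
  refine ⟨m, 0, provable_of_forall_model fun M _ _ v => ?_⟩
  obtain ⟨σ, hσ, hσ', hT⟩ := hN.exists_fun M
  have hp := hp.tr v
  simp only [tr_all, tr_imp, tr_and, tr_has hN.zero_eq hσ, tr_ceq, tr_clt, tv_inst, tv_var,
    push_zero, tv_iter_addOne] at hp ⊢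
  rintro L ⟨hL, -⟩
  obtain ⟨hηL, hc⟩ := hp L hL
  obtain ⟨h1, h2⟩ := hm M σ (L ∷ L ∷ v) L hσ' hL (hT L hL)
    (fun i hi => by obtain rfl : i = 0 := by omega
                    rfl) hηL
  have hS := hL.ceq_succ_iterate hσ' m
  exact ⟨hc.cle.trans ((Cle.of_sub h1).trans hS.symm.cle),
    fun h => h2 (FiniteModel.dedekind _ _ h1 (hc.symm.trans (h.trans hS)))⟩

/-- In the hereditarily finite sets, sums `x +_c x` would be bounded by `x +_c k` for a fixed `k`
if the system were closed under addition. -/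
theorem RankedSystem.not_closedUnder_addition (hN : RankedSystem N) :
    ¬ ClosedUnder₂ N addition := by
  rintro ⟨η, hη, hp⟩
  obtain ⟨k, hk⟩ := exists_bound η 2 hη
  obtain ⟨σ, hσ, hσ', hT⟩ := hN.exists_fun HF
  have h0 : Has σ (sEmpty : HF) := succession_empty
  have hfin := HF.finite_members HF.trueFan
  have h0' : (members (sEmpty : HF)).ncard = 0 := by
    rw [Set.ncard_eq_zero (hfin _)]
    exact Set.eq_empty_iff_forall_notMem.2 fun x (hx : x ε sEmpty) => not_mem_sEmpty hx
  set L : HF := (sSucc σ)^[k + 1] sEmpty with hLdef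
  have hL : Has σ L := h0.succ_iterate hσ' (k + 1)
  have hcard : (members L).ncard = k + 1 := by
    rw [(ncard_succ_iterate h0 hσ' (hfin _) (k + 1)).2, h0', zero_add]
  have hp := hp.tr fun _ => L
  simp only [tr_all, tr_imp, tr_and, tr_has hN.zero_eq hσ, tr_ceq, tv_inst₂, tv_var, push_zero,
    push_one, tv_addition] at hp
  obtain ⟨hηL, hc⟩ := hp L L ⟨hL, hL⟩
  obtain ⟨h1, -⟩ := hk HF σ _ L hσ' hL (hT L hL)
    (fun i hi => by obtain rfl | rfl : i = 0 ∨ i = 1 := by omega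
                    all_goals rfl) hηL
  have h2 := hc.ncard_eq
  rw [ncard_members_sAdd (hfin _) (hfin _), hcard] at h2
  obtain ⟨hf, h3⟩ := ncard_succ_iterate hL hσ' (hfin _) k
  have h4 := Set.ncard_le_ncard (t := members ((sSucc σ)^[k] L)) h1 hf
  rw [h3, hcard] at h4
  have h5 : 2 * (k + 1) ≤ k + 1 + k := by rw [two_mul, h2]; exact h4
  omega

end Final

end EA

theorem mainTheorem4 :
    ∀ N : EA.IterationSystem, (N = EA.CH ∨ N = EA.VN ∨ N = EA.Zermelo) →
      EA.MaximallyPowerful N EA.addOne ∧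
      (∀ n : ℕ, EA.ClosedUnder N (EA.iter EA.addOne n)) ∧
      ¬ EA.ClosedUnder₂ N EA.addition := by
  intro N h
  have hN : EA.RankedSystem N := by
    rcases h with rfl | rfl | rfl
    exacts [EA.rankedSystem_CH, EA.rankedSystem_VN, EA.rankedSystem_Zermelo]
  exact ⟨⟨hN.isNatSystem, EA.isArithmetical_addOne, EA.isIncreasing_addOne,
    hN.closedUnder (n := 1) fun _ _ _ v => EA.tv_addOne v,
    fun _ _ hψ => hN.exists_dominates hψ⟩,
    fun n => hN.closedUnder fun _ _ _ v => EA.tv_iter_addOne v n, hN.not_closedUnder_addition⟩
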